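/- Let $V$ and $V'$ be left vector spaces of the same finite dimension $n$ over division rings $R$ and $R'$, and let $1<k<n-1$. Write $\mathcal G_m(V)$ for the set of $m$-dimensional subspaces of $V$; the Grassmann graph $\Gamma_m(V)$ has vertex set $\mathcal G_m(V)$, two vertices being adjacent when their intersection is $(m-1)$-dimensional. The Johnson graph $J(n,k)$ has the $k$-element subsets of $\{1,\dots,n\}$ as vertices, two being adjacent when their intersection has $k-1$ elements. A $J(n,k)$-subset of $\mathcal G_{k}(V')$ is the image of an isometric embedding of $J(n,k)$ in $\Gamma_{k}(V')$, i.e. of an injection that preserves adjacency, non-adjacency and the distance between any two vertices. The apartment of $\mathcal G_k(V)$ associated with a base $B$ of $V$ consists of all $k$-dimensional subspaces spanned by subsets of $B$. For subspaces $S\subset U$ of $V'$ with $\dim S<k<\dim U$, the set $[S,U]_k=\{P\in\mathcal G_k(V'): S\subset P\subset U\}$ is called a parabolic subspace of $\mathcal G_k(V')$; an apartment in it is the intersection of $[S,U]_k$ with the apartment of $\mathcal G_k(V')$ associated with a base of $V'$ such that $S$ and $U$ are spanned by subsets of this base. A mapping $f:\mathcal G_k(V)\to\mathcal G_k(V')$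 is a $J$-mapping if it sends every apartment of $\mathcal G_k(V)$ to a $J(n,k)$-subset of $\mathcal G_k(V')$; a $J$-mapping is strong if the image of some apartment of $\mathcal G_k(V)$ is an apartment in a parabolic subspace of $\mathcal G_k(V')$. A semilinear embedding of $V$ in a left vector space $W$ over a division ring $Q$ is an additive injection $l:V\to W$ with $l(ax)=\sigma(a)l(x)$ for some ring homomorphism $\sigma:R\to Q$ which sends any $n$ linearly independent vectors to linearly independent vectors. The dual space $V'^*$ is regarded as a left vector space over the opposite division ring of $R'$. Then for every strong $J$-mapping $f:\mathcal G_k(V)\to\mathcal G_k(V')$ at least one of the following holds: (1) there is a semilinear embedding $l:V\to V'$ such that $f(P)=\langle l(P)\rangle$ for all $P\in\mathcal G_k(V)$; (2) there is a semilinear embedding $s:V\to V'^*$ such that $f(P)=\langle s(P)\rangle^0=\{x\in V': x^*(x)=0\ \text{for all } x^*\in\langle s(P)\rangle\}$ for all $P\in\mathcal G_k(V)$. Moreover, (2) can hold only if $n=2k$. -/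

import Mathlib

open Module

namespace GrassmannGraph

section Grassmannian

variable {R V : Type*} [DivisionRing R] [AddCommGroup V] [Module R V]

variable (R V) in
/-- The Grassmannian of `k`-dimensional subspaces of the left vector space `V`. -/
abbrev Gr (k : ℕ) : Type _ := {P : Submodule R V // finrank R P = k}

variable (R V) in
/-- The Grassmann graph: two `k`-dimensional subspaces are adjacent if and only if their
intersection has dimension `k - 1`. -/
def grassmannGraph (k : ℕ) : SimpleGraph (Gr R V k) where
  Adj P Q := finrank R (P.1 ⊓ Q.1 : Submodule R V) + 1 = k
  symm := ⟨fun P Q h => by rwa [inf_comm]⟩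
  loopless := ⟨fun P h => by
    have := P.2
    rw [inf_idem] at h
    omega⟩

/-- The Johnson graph `J(n,k)`: the vertices are the `k`-element subsets of an `n`-element set,
two of them being adjacent if and only if they have `k - 1` elements in common. -/
def johnsonGraph (n k : ℕ) : SimpleGraph {X : Finset (Fin n) // X.card = k} where
  Adj X Y := (X.1 ∩ Y.1).card + 1 = k
  symm := ⟨fun X Y h => by rwa [Finset.inter_comm]⟩
  loopless := ⟨fun X h => by
    have := X.2
    rw [Finset.inter_self] at h
    omega⟩

/-- An isometric embedding of graphs: an embedding (injective, preserving both adjacency and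
non-adjacency) which preserves the distance between any two vertices. -/
def IsIsometricEmbedding {A B : Type*} (G : SimpleGraph A) (H : SimpleGraph B) (g : A → B) :
    Prop :=
  Function.Injective g ∧ (∀ x y, H.Adj (g x) (g y) ↔ G.Adj x y) ∧
    ∀ x y, H.dist (g x) (g y) = G.dist x y

/-- The subset of `Gr R V k` formed by all `k`-dimensional subspaces spanned by subsets of the
base `b`. -/
def apartment {ι : Type*} (b : Basis ι R V) (k : ℕ) : Set (Gr R V k) :=
  {P | ∃ I : Set ι, P.1 = Submodule.span R (b '' I)}

/-- `A` is an apartment of `Gr R V k`. -/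
def IsApartment {k : ℕ} (A : Set (Gr R V k)) : Prop :=
  ∃ b : Basis (Fin (finrank R V)) R V, A = apartment b k

/-- The set `[S,U]_k` of all `k`-dimensional subspaces `P` with `S ≤ P ≤ U`. -/
def interval (S U : Submodule R V) (k : ℕ) : Set (Gr R V k) :=
  {P | S ≤ P.1 ∧ P.1 ≤ U}

/-- The condition on `S`, `U` under which `[S,U]_k` is a parabolic subspace. -/
def IsParabolicPair (S U : Submodule R V) (k : ℕ) : Prop :=
  S ≤ U ∧ finrank R S < k ∧ k < finrank R U

/-- `A` is an apartment in `[S,U]_k`: for some base `b` such that `S` and `U` are spanned by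
subsets of `b`, it is the intersection of the apartment associated with `b` and `[S,U]_k`. -/
def IsApartmentIn {k : ℕ} (S U : Submodule R V) (A : Set (Gr R V k)) : Prop :=
  ∃ b : Basis (Fin (finrank R V)) R V,
    (∃ I, S = Submodule.span R (b '' I)) ∧ (∃ I, U = Submodule.span R (b '' I)) ∧
      A = apartment b k ∩ interval S U k

/-- A `J(n,k)`-subset of `Gr R V m`: the image of an isometric embedding of the Johnson graph
`J(n,k)` in the Grassmann graph. -/
def IsJSubset (n k : ℕ) {m : ℕ} (A : Set (Gr R V m)) : Prop :=
  ∃ g : {X : Finset (Fin n) // X.card = k} → Gr R V m,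
    IsIsometricEmbedding (johnsonGraph n k) (grassmannGraph R V m) g ∧ Set.range g = A

/-- The annihilator in `V` of a subspace `T` of the dual space `V^*`, the latter being a left vector
space over the opposite division ring. Under the identification of `V` with `V^**` this is the
annihilator of `T`. -/
def annihilator (T : Submodule Rᵐᵒᵖ (Dual R V)) : Submodule R V where
  carrier := {x | ∀ φ ∈ T, φ x = 0}
  add_mem' {x y} hx hy φ hφ := by simp [hx φ hφ, hy φ hφ]
  zero_mem' φ _ := map_zero φ
  smul_mem' a x hx φ hφ := by simp [hx φ hφ]

end Grassmannian

section Maps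

variable {R R' V V' : Type*} [DivisionRing R] [AddCommGroup V] [Module R V]
  [DivisionRing R'] [AddCommGroup V'] [Module R' V']

/-- `f` is a `J`-mapping: every apartment goes to a `J(n,k)`-subset, where `n = dim V`. -/
def IsJMapping {k k' : ℕ} (f : Gr R V k → Gr R' V' k') : Prop :=
  ∀ A, IsApartment A → IsJSubset (finrank R V) k (f '' A)

/-- A `J`-mapping is strong if the image of some apartment is an apartment in a parabolic
subspace. -/
def IsStrongJMapping {k k' : ℕ} (f : Gr R V k → Gr R' V' k') : Prop :=
  IsJMapping f ∧ ∃ A, IsApartment A ∧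
    ∃ S U : Submodule R' V', IsParabolicPair S U k' ∧ IsApartmentIn S U (f '' A)

/-- A semilinear `m`-embedding: a semilinear injection which transfers any `m` linearly independent
vectors to linearly independent vectors. -/
def IsSemilinearMEmbedding {σ : R →+* R'} (m : ℕ) (l : V →ₛₗ[σ] V') : Prop :=
  Function.Injective l ∧
    ∀ v : Fin m → V, LinearIndependent R v → LinearIndependent R' (fun i => l (v i))

/-- A semilinear embedding: a semilinear `n`-embedding, where `n = dim V`. -/
def IsSemilinearEmbedding {σ : R →+* R'} (l : V →ₛₗ[σ] V') : Prop :=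
  IsSemilinearMEmbedding (finrank R V) l

/-- `f` is induced by a semilinear embedding `l` of `V` in `V'`: it sends every `P` to the span of
`l(P)`. -/
def IsInducedByEmbedding {k k' : ℕ} (f : Gr R V k → Gr R' V' k') : Prop :=
  ∃ (σ : R →+* R') (l : V →ₛₗ[σ] V'), IsSemilinearEmbedding l ∧
    ∀ P, (f P).1 = Submodule.span R' (l '' (P.1 : Set V))

/-- `f` is induced by a semilinear embedding `s` of `V` in `V'^*`: it sends every `P` to the
annihilator of the span of `s(P)`. -/
def IsInducedByDualEmbedding {k k' : ℕ} (f : Gr R V k → Gr R' V' k') : Prop :=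
  ∃ (σ : R →+* R'ᵐᵒᵖ) (s : V →ₛₗ[σ] Dual R' V'), IsSemilinearEmbedding s ∧
    ∀ P, (f P).1 = annihilator (Submodule.span R'ᵐᵒᵖ (s '' (P.1 : Set V)))

end Maps

end GrassmannGraph

set_option linter.unusedSectionVars false

/-! Both graph distances are `k` minus the size (dimension) of the intersection, so a
`J(n,k)`-subset is a family of `k`-dimensional subspaces indexed by `k`-subsets in which `g I ⊓ g J`
has dimension `|I ∩ J|`. Three members sharing `k - 1` indices either contain the intersection of
any two of them (a star) or lie in the sum of any two (a top). The same alternative holds throughout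
the family (`IsJohnsonFamily.star_or_top`). If the family spans the whole space and has zero
intersection, it is an apartment, indexed naturally or, only for `n = 2k`, by complements
(`IsJohnsonFamily.exists_frame`). All this takes place in a modular lattice with a rank: passing to
the opposite lattice exchanges stars with tops, and `k` with `n - k`.

Strongness and the equality of dimensions yield one apartment whose image is, by counting, a full
apartment. The elementary change `v i ↦ v i + c • v j` of a base moves only the `(n-2).choose (k-1)`
members with `i ∈ I`, `j ∉ I`. The images of the others still span `V'` and have zero intersection,
so the image of the new apartment is again an apartment. Since elementary changes connect all bases,
every apartment goes to an apartment. The moved sets of members are recognisable in the image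
(`IsFrame.eq_complementSet_or`), and a double count based on them shows that `f` preserves `|I ∩ J|`
on every apartment. Hence `f` is natural or complementary there.

Natural type is inherited under elementary changes. It makes `f` assign to every base vector a point
of `V'` independent of the base. The resulting map of points respects lines and independent triples,
and a non-surjective form of the fundamental theorem of projective geometry
(`IsPointMap.exists_semilinearMap`) yields the semilinear embedding. In the complementary case `n =
2k`, and composing `f` with the annihilator gives a mapping of natural type into the dual space.
Finally, in (2) the dimension of `f P` is `n - k`, so (2) requires `n = 2k`. -/

namespace GrassmannGraph

/-! ### Modular lattices with a rank, and Johnson families in them -/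

section Rank

/-- `r` is a rank function of the bounded lattice `L`, and the rank of `L` is `n`. -/
structure IsRank {L : Type*} [Lattice L] [BoundedOrder L] (r : L → ℕ) (n : ℕ) : Prop where
  strictMono : StrictMono r
  modular : ∀ x y, r (x ⊔ y) + r (x ⊓ y) = r x + r y
  bot : r ⊥ = 0
  top : r ⊤ = n

variable {L : Type*} [Lattice L] [BoundedOrder L] {r : L → ℕ} {n : ℕ}

theorem IsRank.mono (hr : IsRank r n) {x y : L} (h : x ≤ y) : r x ≤ r y :=
  hr.strictMono.monotone h

theorem IsRank.eq_of_le (hr : IsRank r n) {x y : L} (h : x ≤ y) (h' : r y ≤ r x) : x = y := by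
  by_contra hne
  exact absurd (hr.strictMono (lt_of_le_of_ne h hne)) (by omega)

theorem IsRank.eq_bot (hr : IsRank r n) {x : L} (h : r x = 0) : x = ⊥ :=
  (hr.eq_of_le bot_le (by simp [h])).symm

theorem IsRank.le (hr : IsRank r n) (x : L) : r x ≤ n := hr.top ▸ hr.mono le_top

/-- This is why the argument is lattice-theoretic: every statement about stars and joins can be
reused for tops and meets. -/
theorem IsRank.dual (hr : IsRank r n) :
    IsRank (fun x : Lᵒᵈ => n - r (OrderDual.ofDual x)) n where
  strictMono x y h := by
    have h1 : r (OrderDual.ofDual y) < r (OrderDual.ofDual x) := hr.strictMono h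
    have := hr.le (OrderDual.ofDual x)
    dsimp only
    omega
  modular x y := by
    have h := hr.modular (OrderDual.ofDual x) (OrderDual.ofDual y)
    have h1 := hr.le (OrderDual.ofDual x ⊔ OrderDual.ofDual y)
    have h2 := hr.le (OrderDual.ofDual x)
    have h3 := hr.le (OrderDual.ofDual y)
    have h4 : r (OrderDual.ofDual (x ⊔ y)) =
      r (OrderDual.ofDual x ⊓ OrderDual.ofDual y) := rfl
    have h5 : r (OrderDual.ofDual (x ⊓ y)) =
      r (OrderDual.ofDual x ⊔ OrderDual.ofDual y) := rfl
    have h6 := hr.le (OrderDual.ofDual x ⊓ OrderDual.ofDual y)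
    rw [h4, h5]
    omega
  bot := by
    have : r (OrderDual.ofDual (⊥ : Lᵒᵈ)) = n := hr.top
    omega
  top := by
    have : r (OrderDual.ofDual (⊤ : Lᵒᵈ)) = 0 := hr.bot
    omega

/-- A clique of three elements of rank `k` is contained in a star or in a top. -/
theorem IsRank.inf_le_or_le_sup (hr : IsRank r n) {k : ℕ} {a b c : L}
    (hc : r c = k) (hab : r (a ⊓ b) + 1 = k) (hac : r (a ⊓ c) + 1 = k) (hbc : r (b ⊓ c) + 1 = k) :
    a ⊓ b ≤ c ∨ c ≤ a ⊔ b := by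
  by_cases h : a ⊓ c = b ⊓ c
  · left
    have : a ⊓ c = a ⊓ b := hr.eq_of_le (le_inf inf_le_left (h ▸ inf_le_left)) (by omega)
    rw [← this]
    exact inf_le_right
  · right
    have h1 : a ⊓ c < (a ⊓ c) ⊔ (b ⊓ c) := by
      refine lt_of_le_of_ne le_sup_left fun h2 => h ?_
      have : b ⊓ c ≤ a ⊓ c := by rw [h2]; exact le_sup_right
      exact (hr.eq_of_le this (by omega)).symm
    have h2 := hr.strictMono h1
    have h3 : (a ⊓ c) ⊔ (b ⊓ c) = c :=
      hr.eq_of_le (sup_le inf_le_right inf_le_right) (by omega)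
    rw [← h3]
    exact sup_le_sup inf_le_left inf_le_left

variable {ι : Type*} [DecidableEq ι]

/-- A family of elements of rank `k` indexed by the `k`-element subsets, such that the ranks of the
pairwise intersections are as in the Johnson graph. -/
def IsJohnsonFamily (r : L → ℕ) (k : ℕ) (g : Finset ι → L) : Prop :=
  ∀ I J : Finset ι, I.card = k → J.card = k → r (g I ⊓ g J) = (I ∩ J).card

variable {k : ℕ} {g : Finset ι → L}

theorem IsJohnsonFamily.rank (hg : IsJohnsonFamily r k g) {I : Finset ι} (hI : I.card = k) :
    r (g I) = k := by
  simpa [hI] using hg I I hI hI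

theorem IsJohnsonFamily.rank_sup (hr : IsRank r n) (hg : IsJohnsonFamily r k g) {I J : Finset ι}
    (hI : I.card = k) (hJ : J.card = k) : r (g I ⊔ g J) = (I ∪ J).card := by
  have h1 := hr.modular (g I) (g J)
  have h2 := Finset.card_union_add_card_inter I J
  rw [hg.rank hI, hg.rank hJ, hg I J hI hJ] at h1
  omega

/-- Inside `g M`, of rank `k`, lie `g I ⊓ g M` and `g J ⊓ g M`, with ranks adding up to `k + |I ∩
J|`. By modularity their meet has rank at least `|I ∩ J|`, so it is all of `g I ⊓ g J`. -/
theorem IsJohnsonFamily.inf_le_of_between (hr : IsRank r n) (hg : IsJohnsonFamily r k g)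
    {I J M : Finset ι} (hI : I.card = k) (hJ : J.card = k) (hM : M.card = k) (h1 : I ∩ J ⊆ M)
    (h2 : M ⊆ I ∪ J) : g I ⊓ g J ≤ g M := by
  have e1 := hg I M hI hM
  have e2 := hg J M hJ hM
  have e3 := hr.modular (g I ⊓ g M) (g J ⊓ g M)
  have e4 : r ((g I ⊓ g M) ⊔ (g J ⊓ g M)) ≤ k := by
    rw [← hg.rank hM]
    exact hr.mono (sup_le inf_le_right inf_le_right)
  have e5 : (I ∩ M).card + (J ∩ M).card = k + (I ∩ J).card := by
    rw [← Finset.card_union_add_card_inter, ← hM]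
    congr 2
    · grind
    · grind
  have e6 : (g I ⊓ g M) ⊓ (g J ⊓ g M) ≤ g I ⊓ g J := inf_le_inf inf_le_left inf_le_left
  have e7 := hr.eq_of_le e6 (by rw [hg I J hI hJ]; omega)
  rw [← e7]
  exact inf_le_left.trans inf_le_right

/-- The dual count: `g I ⊔ g M` and `g J ⊔ g M` meet in rank at least `k`, so their join has rank at
most `|I ∪ J|`, which is already the rank of `g I ⊔ g J`. -/
theorem IsJohnsonFamily.le_sup_of_between (hr : IsRank r n) (hg : IsJohnsonFamily r k g)
    {I J M : Finset ι} (hI : I.card = k) (hJ : J.card = k) (hM : M.card = k) (h1 : I ∩ J ⊆ M)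
    (h2 : M ⊆ I ∪ J) : g M ≤ g I ⊔ g J := by
  have e1 := hg.rank_sup hr hI hM
  have e2 := hg.rank_sup hr hJ hM
  have e3 := hr.modular (g I ⊔ g M) (g J ⊔ g M)
  have e4 : k ≤ r ((g I ⊔ g M) ⊓ (g J ⊔ g M)) := by
    rw [← hg.rank hM]
    exact hr.mono (le_inf le_sup_right le_sup_right)
  have e5 : (I ∪ M).card + (J ∪ M).card = (I ∪ J).card + k := by
    rw [← Finset.card_union_add_card_inter, ← hM]
    congr 2
    · grind
    · grind
  have e6 : g I ⊔ g J ≤ (g I ⊔ g M) ⊔ (g J ⊔ g M) := sup_le_sup le_sup_left le_sup_left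
  have e7 := hr.eq_of_le e6 (by rw [hg.rank_sup hr hI hJ]; omega)
  rw [e7]
  exact le_sup_right.trans le_sup_left

end Rank

/-! ### Stars and tops: the type of a triangle is constant -/

section Triangles

variable {L : Type*} [Lattice L] [BoundedOrder L] {r : L → ℕ} {n : ℕ}
  {ι : Type*} [DecidableEq ι] {k : ℕ} {g : Finset ι → L}

theorem IsJohnsonFamily.rank_le_of_le_of_le (hr : IsRank r n) (hg : IsJohnsonFamily r k g)
    {I J : Finset ι} (hI : I.card = k) (hJ : J.card = k) {m : L} (h1 : m ≤ g I) (h2 : m ≤ g J) :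
    r m ≤ (I ∩ J).card := hg I J hI hJ ▸ hr.mono (le_inf h1 h2)

theorem IsJohnsonFamily.le_rank_of_le_of_le (hr : IsRank r n) (hg : IsJohnsonFamily r k g)
    {I J : Finset ι} (hI : I.card = k) (hJ : J.card = k) {m : L} (h1 : g I ≤ m) (h2 : g J ≤ m) :
    (I ∪ J).card ≤ r m := hg.rank_sup hr hI hJ ▸ hr.mono (sup_le h1 h2)

theorem pair_inter_of_disjoint {N : Finset ι} {a b c d : ι} (hac : a ≠ c) (had : a ≠ d)
    (hbc : b ≠ c) (hbd : b ≠ d) (ha : a ∉ N) (hb : b ∉ N) :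
    insert a (insert b N) ∩ insert c (insert d N) = N := by
  grind

theorem pair_inter_of_common {N : Finset ι} {a b d : ι} (hbd : b ≠ d) (_hb : b ∉ N) :
    insert a (insert b N) ∩ insert a (insert d N) = insert a N := by
  grind

variable {N : Finset ι}

/-- A star on `xa`, `xb`, `xc` over `N` forces `ab` below the join of `xa` and `xb`: otherwise `ab`
and `xc` would share rank `k - 1`, while their index sets meet in `N`, of size `k - 2`. That join
then has no room for `xd` or `ac`, so the corresponding triangles cannot be tops. The second
conclusion moves the core from `N ∪ {x}` to `N ∪ {a}`. -/
theorem IsJohnsonFamily.star_of_star (hr : IsRank r n) (hg : IsJohnsonFamily r k g)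
    (hN : N.card + 2 = k) {x a b c d : ι} (hd : [x, a, b, c].Nodup) (hd' : [x, a, b, d].Nodup)
    (hx : x ∉ N) (ha : a ∉ N) (hb : b ∉ N) (hc : c ∉ N) (hdN : d ∉ N)
    (h : g (insert x (insert a N)) ⊓ g (insert x (insert b N)) ≤ g (insert x (insert c N))) :
    g (insert x (insert a N)) ⊓ g (insert x (insert b N)) ≤ g (insert x (insert d N)) ∧
    g (insert a (insert x N)) ⊓ g (insert a (insert b N)) ≤ g (insert a (insert c N)) := by
  simp only [List.nodup_cons, List.mem_cons, List.not_mem_nil, or_false, not_or, not_false_eq_true,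
    List.nodup_nil, and_true] at hd hd'
  obtain ⟨⟨hxa, hxb, hxc⟩, ⟨hab, hac⟩, hbc⟩ := hd
  obtain ⟨⟨-, -, hxd⟩, ⟨-, had⟩, hbd⟩ := hd'
  have card2 : ∀ {p q}, p ≠ q → p ∉ N → q ∉ N → (insert p (insert q N)).card = k := by
    intro p q hpq hp hq
    rw [Finset.card_insert_of_notMem (by grind), Finset.card_insert_of_notMem hq]
    omega
  have edge : ∀ {p q s}, p ≠ q → p ≠ s → q ≠ s → p ∉ N → q ∉ N → s ∉ N →
      r (g (insert p (insert q N)) ⊓ g (insert p (insert s N))) + 1 = k := by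
    intro p q s hpq hps hqs hp hq hs
    rw [hg _ _ (card2 hpq hp hq) (card2 hps hp hs), pair_inter_of_common hqs hq,
      Finset.card_insert_of_notMem hp]
    omega
  have xa := card2 hxa hx ha
  have xb := card2 hxb hx hb
  have xc := card2 hxc hx hc
  have xd := card2 hxd hx hdN
  have ab := card2 hab ha hb
  have ac := card2 hac ha hc
  have r1 := edge hxa hxb hab hx ha hb
  have rs : r (g (insert x (insert a N)) ⊔ g (insert x (insert b N))) = k + 1 := by
    have := hr.modular (g (insert x (insert a N))) (g (insert x (insert b N)))
    rw [hg.rank xa, hg.rank xb] at this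
    omega
  have cax : (insert a (insert x N)) = insert x (insert a N) := Finset.insert_comm _ _ _
  have cab : (insert a (insert b N)) = insert b (insert a N) := Finset.insert_comm _ _ _
  have cbx : (insert b (insert x N)) = insert x (insert b N) := Finset.insert_comm _ _ _
  -- Two members whose index sets meet in `N` have a join of rank `k + 2`, too large for an element
  -- of rank `k + 1`.
  have far : ∀ {p q s t}, p ≠ s → p ≠ t → q ≠ s → q ≠ t → p ≠ q → s ≠ t → p ∉ N → q ∉ N →
      s ∉ N → t ∉ N → g (insert p (insert q N)) ≤
        g (insert x (insert a N)) ⊔ g (insert x (insert b N)) →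
      ¬ g (insert s (insert t N)) ≤ g (insert x (insert a N)) ⊔ g (insert x (insert b N)) := by
    intro p q s t h1 h2 h3 h4 h5 h6 hp hq hs ht hle1 hle2
    have e1 := hg.le_rank_of_le_of_le hr (card2 h5 hp hq) (card2 h6 hs ht) hle1 hle2
    have e2 := Finset.card_union_add_card_inter (insert p (insert q N)) (insert s (insert t N))
    rw [pair_inter_of_disjoint h1 h2 h3 h4 hp hq, card2 h5 hp hq, card2 h6 hs ht] at e2
    omega
  have top : g (insert a (insert b N)) ≤
      g (insert x (insert a N)) ⊔ g (insert x (insert b N)) := by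
    refine (hr.inf_le_or_le_sup (hg.rank ab) r1 ?_ ?_).resolve_left fun h' => ?_
    · rw [← cax]
      exact edge (Ne.symm hxa) hab hxb ha hx hb
    · rw [← cbx, cab]
      exact edge (Ne.symm hxb) (Ne.symm hab) hxa hb hx ha
    · have := hg.rank_le_of_le_of_le hr xc ab h h'
      rw [pair_inter_of_disjoint hxa hxb (Ne.symm hac) (Ne.symm hbc) hx hc] at this
      omega
  constructor
  · exact (hr.inf_le_or_le_sup (hg.rank xd) r1 (edge hxa hxd had hx ha hdN)
      (edge hxb hxd hbd hx hb hdN)).resolve_right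
      (far (Ne.symm hxa) had (Ne.symm hxb) hbd hab hxd ha hb hx hdN top)
  · refine (hr.inf_le_or_le_sup (hg.rank ac)
      (edge (Ne.symm hxa) hab hxb ha hx hb) (edge (Ne.symm hxa) hac hxc ha hx hc)
      (edge hab hac hbc ha hb hc)).resolve_right fun h' => ?_
    have e1 : g (insert a (insert x N)) ⊔ g (insert a (insert b N)) ≤
        g (insert x (insert a N)) ⊔ g (insert x (insert b N)) := by
      rw [cax]
      exact sup_le le_sup_left top
    exact far (Ne.symm hxa) hab (Ne.symm hxc) (Ne.symm hbc) hac hxb ha hc hx hb (h'.trans e1)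
      le_sup_right

/-- Every property of finite subsets which is preserved by replacing one element is shared by all
subsets of the same size. -/
theorem forall_of_swap {C : Finset ι → Prop}
    (hC : ∀ (N : Finset ι) (x a : ι), x ∉ N → a ∉ N → x ≠ a → N.card + 1 = k → C (insert x N) →
      C (insert a N)) {K₀ K : Finset ι} (h₀ : K₀.card = k) (h : K.card = k) (hK : C K₀) : C K := by
  induction hm : (K \ K₀).card generalizing K₀ with
  | zero =>
    have : K = K₀ := Finset.eq_of_subset_of_card_le
      (Finset.sdiff_eq_empty_iff_subset.1 (Finset.card_eq_zero.1 hm)) (by omega)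
    exact this ▸ hK
  | succ m ih =>
    have e1 : (K \ K₀).card = (K₀ \ K).card := Finset.card_sdiff_comm (by omega)
    obtain ⟨a, ha⟩ : (K \ K₀).Nonempty := Finset.card_pos.1 (by omega)
    obtain ⟨x, hx⟩ : (K₀ \ K).Nonempty := Finset.card_pos.1 (by omega)
    rw [Finset.mem_sdiff] at ha hx
    have hN : (K₀.erase x).card + 1 = k := by rw [Finset.card_erase_add_one hx.1, h₀]
    have ha' : a ∉ K₀.erase x := fun h => ha.2 (Finset.mem_of_mem_erase h)
    refine ih (K₀ := insert a (K₀.erase x)) ?_ ?_ ?_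
    · rw [Finset.card_insert_of_notMem ha', hN]
    · refine hC _ x a (Finset.notMem_erase _ _) ha' (fun h => ha.2 (h ▸ hx.1)) hN ?_
      rwa [Finset.insert_erase hx.1]
    · have : K \ insert a (K₀.erase x) = (K \ K₀).erase a := by
        ext y
        by_cases hy : y = x <;> simp_all
        tauto
      rw [this, Finset.card_erase_of_mem (Finset.mem_sdiff.2 ha)]
      omega

/-- The family maps stars to stars. -/
def IsStarFamily (k : ℕ) (g : Finset ι → L) : Prop :=
  ∀ (K : Finset ι) (a b c : ι), K.card + 1 = k → a ∉ K → b ∉ K → c ∉ K → a ≠ b → a ≠ c → b ≠ c →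
    g (insert a K) ⊓ g (insert b K) ≤ g (insert c K)

/-- The family maps stars to tops. -/
def IsTopFamily (k : ℕ) (g : Finset ι → L) : Prop :=
  ∀ (K : Finset ι) (a b c : ι), K.card + 1 = k → a ∉ K → b ∉ K → c ∉ K → a ≠ b → a ≠ c → b ≠ c →
    g (insert c K) ≤ g (insert a K) ⊔ g (insert b K)

theorem IsJohnsonFamily.rank_inf_insert (hg : IsJohnsonFamily r k g) {K : Finset ι} {a b : ι}
    (hK : K.card + 1 = k) (ha : a ∉ K) (hb : b ∉ K) (hab : a ≠ b) :
    r (g (insert a K) ⊓ g (insert b K)) + 1 = k := by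
  rw [hg _ _ (by rw [Finset.card_insert_of_notMem ha, hK])
    (by rw [Finset.card_insert_of_notMem hb, hK]), ← hK]
  congr 2
  grind

/-- For a fixed core `K` one star suffices: `star_of_star` replaces the third index, and since all
pairwise meets of a star coincide, the roles of the three indices can be rotated. -/
theorem IsJohnsonFamily.star_at (hr : IsRank r n) (hg : IsJohnsonFamily r k g) (hk : 1 < k)
    {K : Finset ι} (hK : K.card + 1 = k) {a b c : ι} (ha : a ∉ K) (hb : b ∉ K) (hc : c ∉ K)
    (hab : a ≠ b) (hac : a ≠ c) (hbc : b ≠ c)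
    (h : g (insert a K) ⊓ g (insert b K) ≤ g (insert c K)) {a' b' c' : ι} (ha' : a' ∉ K)
    (hb' : b' ∉ K) (hc' : c' ∉ K) (hab' : a' ≠ b') (hac' : a' ≠ c') (hbc' : b' ≠ c') :
    g (insert a' K) ⊓ g (insert b' K) ≤ g (insert c' K) := by
  have step : ∀ {a b c d : ι}, a ∉ K → b ∉ K → c ∉ K → d ∉ K → a ≠ b → a ≠ c → b ≠ c → a ≠ d →
      b ≠ d → g (insert a K) ⊓ g (insert b K) ≤ g (insert c K) →
      g (insert a K) ⊓ g (insert b K) ≤ g (insert d K) := by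
    intro a b c d ha hb hc hd hab hac hbc had hbd h
    obtain ⟨x, hx⟩ : K.Nonempty := Finset.card_pos.1 (by omega)
    have hN : (K.erase x).card + 2 = k := by have := Finset.card_erase_add_one hx; omega
    have hcomm : ∀ y, insert y K = insert x (insert y (K.erase x)) := fun y => by
      rw [Finset.insert_comm, Finset.insert_erase hx]
    rw [hcomm a, hcomm b] at h ⊢
    rw [hcomm c] at h
    rw [hcomm d]
    exact (hg.star_of_star hr hN (by simp; grind) (by simp; grind) (Finset.notMem_erase _ _)
      (by grind) (by grind) (by grind) (by grind) h).1
  have rot : ∀ {a b c : ι}, a ∉ K → b ∉ K → c ∉ K → a ≠ b → a ≠ c → b ≠ c →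
      g (insert a K) ⊓ g (insert b K) ≤ g (insert c K) →
      g (insert a K) ⊓ g (insert c K) ≤ g (insert b K) := by
    intro a b c ha hb hc hab hac hbc h
    have e := hr.eq_of_le (le_inf inf_le_left h) (by
      have := hg.rank_inf_insert hK ha hb hab
      have := hg.rank_inf_insert hK ha hc hac
      omega)
    rw [← e]
    exact inf_le_right
  have any : ∀ {a b : ι}, a ∉ K → b ∉ K → a ≠ b → (∀ c, c ∉ K → a ≠ c → b ≠ c →
      g (insert a K) ⊓ g (insert b K) ≤ g (insert c K)) → ∀ b', b' ∉ K → a ≠ b' → (∀ c, c ∉ K →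
      a ≠ c → b' ≠ c → g (insert a K) ⊓ g (insert b' K) ≤ g (insert c K)) := by
    intro a b ha hb hab h b' hb' hab' c hc hac hbc'
    by_cases hbb : b = b'
    · subst hbb
      exact h c hc hac hbc'
    · exact step ha hb' hb hc hab' hab (Ne.symm hbb) hac hbc'
        (rot ha hb hb' hab hab' hbb (h b' hb' hab' hbb))
  have h1 : ∀ c, c ∉ K → a ≠ c → b ≠ c → g (insert a K) ⊓ g (insert b K) ≤ g (insert c K) :=
    fun d hd had hbd => step ha hb hc hd hab hac hbc had hbd h
  by_cases haa : a = a'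
  · subst haa
    exact any ha hb hab h1 b' hb' hab' c' hc' hac' hbc'
  · have h2 := any ha hb hab h1 a' ha' haa
    exact any ha' ha (Ne.symm haa)
      (fun c hc h3 h4 => by rw [inf_comm]; exact h2 c hc h4 h3) b' hb' hab' c' hc' hac' hbc'

/-- If some triangle is not a top, it is a star. The star property then passes from its core to
every other core by exchanging one element at a time. -/
theorem IsJohnsonFamily.star_or_top [Fintype ι] (hr : IsRank r n) (hg : IsJohnsonFamily r k g)
    (hk : 1 < k) (hkn : k + 1 < Fintype.card ι) : IsStarFamily k g ∨ IsTopFamily k g := by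
  by_contra hcon
  rw [not_or] at hcon
  refine hcon.2 fun K a b c hK ha hb hc hab hac hbc => ?_
  by_contra hnot
  have hstar := (hr.inf_le_or_le_sup (hg.rank (by rw [Finset.card_insert_of_notMem hc, hK]))
    (hg.rank_inf_insert hK ha hb hab)
    (hg.rank_inf_insert hK ha hc hac) (hg.rank_inf_insert hK hb hc hbc)).resolve_right hnot
  refine hcon.1 fun K' a' b' c' hK' => ?_
  revert a' b' c'
  refine forall_of_swap (k := k - 1) (K₀ := K) (C := fun K' => ∀ a b c, a ∉ K' → b ∉ K' → c ∉ K' →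
    a ≠ b → a ≠ c → b ≠ c → g (insert a K') ⊓ g (insert b K') ≤ g (insert c K')) ?_ (by omega)
    (by omega) ?_
  · intro N x a hx ha hxa hN h a' b' c' ha' hb' hc' hab' hac' hbc'
    have hNk : N.card + 2 = k := by omega
    -- `N ∪ {x, a}` has `k` elements, and `k + 1 < n` leaves two further indices to complete a
    -- triangle over either core.
    have hcard : 1 < ((insert x (insert a N))ᶜ).card := by
      rw [Finset.card_compl, Finset.card_insert_of_notMem (by grind),
        Finset.card_insert_of_notMem ha]
      omega
    obtain ⟨b, hb, c, hc, hbc⟩ := Finset.one_lt_card.1 hcard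
    simp only [Finset.mem_compl, Finset.mem_insert, not_or] at hb hc
    have h1 := h a b c (by grind) (by grind) (by grind) (by grind) (by grind) (by grind)
    rw [Finset.insert_comm a, Finset.insert_comm b, Finset.insert_comm c] at h1
    have h2 := (hg.star_of_star hr hNk (d := c) (by simp; grind) (by simp; grind)
      hx ha hb.2.2 hc.2.2 hc.2.2 h1).2
    rw [Finset.insert_comm a, Finset.insert_comm a, Finset.insert_comm a] at h2
    exact hg.star_at hr hk (by rw [Finset.card_insert_of_notMem ha]; omega) (by grind) (by grind)
      (by grind) (by grind) (by grind) (by grind) h2 ha' hb' hc' hab' hac' hbc'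
  · intro a' b' c' ha' hb' hc' hab' hac' hbc'
    exact hg.star_at hr hk hK ha hb hc hab hac hbc hstar ha' hb' hc' hab' hac' hbc'

end Triangles
-- Frames, and Johnson families that come from them
section Frames

variable {L : Type*} [Lattice L] [BoundedOrder L] {r : L → ℕ} {n : ℕ}
  {ι : Type*} [Fintype ι] [DecidableEq ι] {k : ℕ} {g : Finset ι → L}

/-- The lattice of the subspaces spanned by the subsets of a base, in terms of ranks. -/
structure IsFrame (r : L → ℕ) (h : Finset ι → L) : Prop where
  sup : ∀ I J, h (I ∪ J) = h I ⊔ h J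
  rank : ∀ I, r (h I) = I.card

variable {h : Finset ι → L}

theorem IsFrame.mono (hh : IsFrame r h) {I J : Finset ι} (hIJ : I ⊆ J) : h I ≤ h J := by
  rw [← Finset.union_eq_right.2 hIJ, hh.sup]
  exact le_sup_left

theorem IsFrame.inf (hr : IsRank r n) (hh : IsFrame r h) (I J : Finset ι) :
    h (I ∩ J) = h I ⊓ h J := by
  refine hr.eq_of_le (le_inf (hh.mono Finset.inter_subset_left) (hh.mono Finset.inter_subset_right))
    ?_
  have h1 := hr.modular (h I) (h J)
  have h2 := Finset.card_union_add_card_inter I J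
  rw [← hh.sup, hh.rank, hh.rank, hh.rank] at h1
  rw [hh.rank]
  omega

theorem IsFrame.subset_of_le (hr : IsRank r n) (hh : IsFrame r h) {I J : Finset ι}
    (hIJ : h I ≤ h J) : I ⊆ J := by
  have h1 : h (I ∩ J) = h I := by rw [hh.inf hr, inf_eq_left.2 hIJ]
  have h2 := congrArg r h1
  rw [hh.rank, hh.rank] at h2
  exact Finset.inter_eq_left.1 (Finset.eq_of_subset_of_card_le Finset.inter_subset_left h2.ge)

theorem IsFrame.injective (hr : IsRank r n) (hh : IsFrame r h) : Function.Injective h :=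
  fun _ _ e => (hh.subset_of_le hr e.le).antisymm (hh.subset_of_le hr e.ge)

theorem IsFrame.empty (hr : IsRank r n) (hh : IsFrame r h) : h ∅ = ⊥ :=
  hr.eq_bot (by rw [hh.rank, Finset.card_empty])

theorem IsFrame.univ (hr : IsRank r n) (hn : Fintype.card ι = n) (hh : IsFrame r h) :
    h Finset.univ = ⊤ :=
  hr.eq_of_le le_top (by rw [hh.rank, Finset.card_univ, hn, hr.top])

/-- Infima of subsets of a frame. -/
theorem IsFrame.le_of_forall (hr : IsRank r n) (hn : Fintype.card ι = n) (hh : IsFrame r h)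
    {x : L} {T : Finset ι} (hx : ∀ j, j ∉ T → ∃ I : Finset ι, j ∉ I ∧ x ≤ h I) : x ≤ h T := by
  -- Indices outside `T` are removed one at a time; meeting with the `h I` given for `j` removes
  -- `j`.
  have key : ∀ S : Finset ι, Disjoint S T → x ≤ h Sᶜ := by
    intro S
    induction S using Finset.induction_on with
    | empty => intro _; rw [Finset.compl_empty, hh.univ hr hn]; exact le_top
    | insert j S hj ih =>
      intro hd
      rw [Finset.disjoint_insert_left] at hd
      obtain ⟨I, hjI, hxI⟩ := hx j hd.1
      refine (le_inf (ih hd.2) hxI).trans ?_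
      rw [← hh.inf hr]
      refine hh.mono ?_
      intro y hy
      simp only [Finset.mem_inter, Finset.mem_compl, Finset.mem_insert, not_or] at hy ⊢
      exact ⟨fun e => hjI (e ▸ hy.2), hy.1⟩
  simpa using key Tᶜ disjoint_compl_left

theorem IsFrame.le_of_forall_singleton (hh : IsFrame r h) (hr : IsRank r n)
    {x : L} {T : Finset ι} (hx : ∀ j ∈ T, h {j} ≤ x) : h T ≤ x := by
  induction T using Finset.induction_on with
  | empty => rw [hh.empty hr]; exact bot_le
  | insert j S hj ih =>
    rw [Finset.insert_eq, hh.sup]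
    exact sup_le (hx j (Finset.mem_insert_self _ _))
      (ih fun i hi => hx i (Finset.mem_insert_of_mem hi))

/-- Complements are needed because a frame of the opposite lattice turns unions into meets. -/
theorem IsFrame.of_dual (hr : IsRank r n) (hn : Fintype.card ι = n) {h' : Finset ι → Lᵒᵈ}
    (hh : IsFrame (fun x : Lᵒᵈ => n - r (OrderDual.ofDual x)) h') :
    IsFrame r (fun I => OrderDual.ofDual (h' Iᶜ)) where
  sup I J := by
    rw [Finset.compl_union, hh.inf hr.dual]
    rfl
  rank I := by
    have h1 := hh.rank Iᶜ
    have h2 := hr.le (OrderDual.ofDual (h' Iᶜ))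
    have h3 := Finset.card_le_univ I
    rw [Finset.card_compl, hn] at h1
    rw [hn] at h3
    omega

/-- Points which generate the whole lattice form a frame if their number is the rank. -/
theorem isFrame_of_points (hr : IsRank r n) (hn : Fintype.card ι = n) (p : ι → L)
    (hp : ∀ i, r (p i) ≤ 1) (htop : Finset.univ.sup p = ⊤) : IsFrame r (fun I => I.sup p) where
  sup I J := Finset.sup_union
  rank I := by
    have key : ∀ S : Finset ι, r (S.sup p) ≤ S.card := by
      intro S
      induction S using Finset.induction_on with
      | empty => simp [hr.bot]
      | insert j S hj ih =>
        rw [Finset.sup_insert, Finset.card_insert_of_notMem hj]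
        have := hr.modular (p j) (S.sup p)
        have := hp j
        omega
    -- The joins over `I` and `Iᶜ` generate everything, so their ranks sum to at least `n`; both
    -- upper bounds are therefore attained.
    have h1 : I.sup p ⊔ Iᶜ.sup p = ⊤ := by rw [← Finset.sup_union, Finset.union_compl, htop]
    have h2 := hr.modular (I.sup p) (Iᶜ.sup p)
    rw [h1, hr.top] at h2
    have h3 := key I
    have h4 := key Iᶜ
    have h5 := Finset.card_le_univ I
    rw [Finset.card_compl, hn] at h4
    rw [hn] at h5
    omega

/-- A set of `k`-subsets containing everything between `I` and `J`, and closed under the passage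
from two elements of a star to the whole star, contains every `k`-subset which includes `I ∩ J`. -/
theorem mem_of_between_of_star {U : Finset ι → Prop} {I J : Finset ι} (hI : I.card = k)
    (hJ : J.card = k) (hIJ : I ≠ J) (h1 : ∀ M, M.card = k → I ∩ J ⊆ M → M ⊆ I ∪ J → U M)
    (h2 : ∀ (K : Finset ι) (a b c : ι), K.card + 1 = k → a ∉ K → b ∉ K → c ∉ K → a ≠ b → a ≠ c →
      b ≠ c → U (insert a K) → U (insert b K) → U (insert c K)) {M : Finset ι} (hM : M.card = k)
    (hMI : I ∩ J ⊆ M) : U M := by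
  induction hm : (M \ (I ∪ J)).card generalizing M with
  | zero => exact h1 M hM hMI (Finset.sdiff_eq_empty_iff_subset.1 (Finset.card_eq_zero.1 hm))
  | succ m ih =>
    obtain ⟨c, hc⟩ : (M \ (I ∪ J)).Nonempty := Finset.card_pos.1 (by omega)
    have hc' := Finset.mem_sdiff.1 hc
    have hlt : (I ∩ J).card < k := by
      by_contra hge
      have e1 := Finset.eq_of_subset_of_card_le (Finset.inter_subset_left (s₁ := I) (s₂ := J))
        (by omega)
      have e2 := Finset.eq_of_subset_of_card_le (Finset.inter_subset_right (s₁ := I) (s₂ := J))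
        (by omega)
      exact hIJ (e1.symm.trans e2)
    -- As `I ≠ J`, the union has at least `k + 1` elements, and `M` uses at most `k - 1` of them
    -- because `c` lies outside. Exchanging `c` for two unused ones gives two members of the same
    -- star with fewer indices outside `I ∪ J`.
    have hcard : 1 < ((I ∪ J) \ M).card := by
      have e1 := Finset.card_union_add_card_inter I J
      have e2 := Finset.card_sdiff_add_card_inter M (I ∪ J)
      have e3 := Finset.card_sdiff_add_card_inter (I ∪ J) M
      rw [Finset.inter_comm] at e3
      omega
    obtain ⟨a, ha, b, hb, hab⟩ := Finset.one_lt_card.1 hcard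
    rw [Finset.mem_sdiff] at ha hb
    have hK := Finset.card_erase_add_one hc'.1
    have swap : ∀ x ∈ I ∪ J, x ∉ M → U (insert x (M.erase c)) := by
      intro x hx hxM
      have hx' : x ∉ M.erase c := fun h => hxM (Finset.mem_of_mem_erase h)
      refine ih ?_ ?_ ?_
      · rw [Finset.card_insert_of_notMem hx']
        omega
      · intro y hy
        refine Finset.mem_insert_of_mem (Finset.mem_erase.2 ⟨fun e => hc'.2 ?_, hMI hy⟩)
        rw [← e]
        exact Finset.mem_union_left _ (Finset.mem_inter.1 hy).1
      · have : insert x (M.erase c) \ (I ∪ J) = (M \ (I ∪ J)).erase c := by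
          rw [Finset.insert_sdiff_of_mem _ hx, Finset.erase_sdiff_comm]
        rw [this, Finset.card_erase_of_mem hc]
        omega
    have h3 := h2 (M.erase c) a b c (by omega) (fun h => ha.2 (Finset.mem_of_mem_erase h))
      (fun h => hb.2 (Finset.mem_of_mem_erase h)) (Finset.notMem_erase _ _) hab
      (fun e => ha.2 (e ▸ hc'.1)) (fun e => hb.2 (e ▸ hc'.1)) (swap a ha.1 ha.2) (swap b hb.1 hb.2)
    rwa [Finset.insert_erase hc'.1] at h3

theorem IsStarFamily.inf_le (hr : IsRank r n) (hg : IsJohnsonFamily r k g) (hs : IsStarFamily k g)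
    {I J M : Finset ι} (hI : I.card = k) (hJ : J.card = k) (hIJ : I ≠ J) (hM : M.card = k)
    (hMI : I ∩ J ⊆ M) : g I ⊓ g J ≤ g M :=
  mem_of_between_of_star (U := fun M => g I ⊓ g J ≤ g M) hI hJ hIJ
    (fun _ hM h1 h2 => hg.inf_le_of_between hr hI hJ hM h1 h2)
    (fun K a b c hK ha hb hc hab hac hbc h1 h2 =>
      (le_inf h1 h2).trans (hs K a b c hK ha hb hc hab hac hbc)) hM hMI

theorem IsTopFamily.le_sup (hr : IsRank r n) (hg : IsJohnsonFamily r k g) (hs : IsTopFamily k g)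
    {I J M : Finset ι} (hI : I.card = k) (hJ : J.card = k) (hIJ : I ≠ J) (hM : M.card = k)
    (hMI : I ∩ J ⊆ M) : g M ≤ g I ⊔ g J :=
  mem_of_between_of_star (U := fun M => g M ≤ g I ⊔ g J) hI hJ hIJ
    (fun _ hM h1 h2 => hg.le_sup_of_between hr hI hJ hM h1 h2)
    (fun K a b c hK ha hb hc hab hac hbc h1 h2 =>
      (hs K a b c hK ha hb hc hab hac hbc).trans (sup_le h1 h2)) hM hMI

theorem exists_card_eq_of_subset_of_notMem {K : Finset ι} {a : ι} (ha : a ∉ K) (hK : K.card ≤ k)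
    (hk : k < Fintype.card ι) : ∃ I : Finset ι, K ⊆ I ∧ a ∉ I ∧ I.card = k := by
  obtain ⟨I, h1, h2, h3⟩ := Finset.exists_subsuperset_card_eq (s := K) (t := Finset.univ.erase a)
    (fun x hx => Finset.mem_erase.2 ⟨fun e => ha (e ▸ hx), Finset.mem_univ _⟩) hK
    (by rw [Finset.card_erase_of_mem (Finset.mem_univ _), Finset.card_univ]; omega)
  exact ⟨I, h1, fun h => Finset.notMem_erase a _ (h2 h), h3⟩

theorem exists_card_eq_inter {I : Finset ι} (hI : I.card = k) (hk : 2 * k ≤ Fintype.card ι)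
    {a : ι} (hk0 : 0 < k) : ∃ J : Finset ι, a ∈ J ∧ J.card = k ∧ I ∩ J ⊆ {a} := by
  obtain ⟨J, h1, h2, h3⟩ := Finset.exists_subsuperset_card_eq (s := {a}) (t := insert a Iᶜ)
    (n := k) (by simp) (by rwa [Finset.card_singleton]) (by
      refine le_trans ?_ (Finset.card_le_card (Finset.subset_insert _ _))
      rw [Finset.card_compl]
      omega)
  refine ⟨J, h1 (Finset.mem_singleton_self a), h3, fun x hx => ?_⟩
  rw [Finset.mem_inter] at hx
  have := h2 hx.2
  simp only [Finset.mem_insert, Finset.mem_compl] at this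
  simp only [Finset.mem_singleton]
  tauto

/-- For `2 * k ≤ n` every `i` is the intersection of two `k`-subsets, which yields an element `p i`
of rank 1. By the star property `p i` lies below every `g M` with `i ∈ M`, and independence makes
each `g I` the join of its points. -/
theorem IsStarFamily.exists_frame (hr : IsRank r n) (hn : Fintype.card ι = n) (hk : 1 < k)
    (hkn : 2 * k ≤ n) (hg : IsJohnsonFamily r k g) (hs : IsStarFamily k g)
    (htop : ∀ x, (∀ I : Finset ι, I.card = k → g I ≤ x) → x = ⊤) :
    ∃ h : Finset ι → L, IsFrame r h ∧ ∀ I : Finset ι, I.card = k → g I = h I := by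
  have hex : ∀ i : ι, ∃ I J : Finset ι, I.card = k ∧ J.card = k ∧ I ∩ J = {i} := by
    intro i
    obtain ⟨I, h1, -, h2⟩ := Finset.exists_subsuperset_card_eq (s := {i})
      (t := (Finset.univ : Finset ι)) (n := k) (by simp) (by simp; omega) (by simp; omega)
    obtain ⟨J, h3, h4, h5⟩ := exists_card_eq_inter h2 (hn ▸ hkn) (a := i) (by omega)
    refine ⟨I, J, h2, h4, h5.antisymm ?_⟩
    rw [Finset.singleton_subset_iff, Finset.mem_inter]
    exact ⟨h1 (Finset.mem_singleton_self i), h3⟩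
  choose A B hA hB hAB using hex
  have hp1 : ∀ i, r (g (A i) ⊓ g (B i)) = 1 := fun i => by
    rw [hg _ _ (hA i) (hB i), hAB, Finset.card_singleton]
  have hple : ∀ i (M : Finset ι), M.card = k → i ∈ M → g (A i) ⊓ g (B i) ≤ g M := by
    intro i M hM hi
    refine hs.inf_le hr hg (hA i) (hB i) (fun e => ?_) hM ?_
    · have h1 := congrArg Finset.card (hAB i)
      rw [e, Finset.inter_self, hB, Finset.card_singleton] at h1
      omega
    · rw [hAB]
      simpa using hi
  set p : ι → L := fun i => g (A i) ⊓ g (B i) with hp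
  -- Independence of a new point `p a`: `K` extends to a `k`-subset `I` avoiding `a`, and `a` lies
  -- in a `k`-subset `J` disjoint from `I`. Then `p a ⊓ K.sup p` lies below `g I ⊓ g J`, of rank 0.
  have hrank : ∀ K : Finset ι, K.card ≤ k → r (K.sup p) = K.card := by
    intro K
    induction K using Finset.induction_on with
    | empty => simp [hr.bot]
    | insert a K ha ih =>
      intro hK
      rw [Finset.card_insert_of_notMem ha] at hK ⊢
      obtain ⟨I, hKI, haI, hI⟩ := exists_card_eq_of_subset_of_notMem ha (k := k) (by omega)
        (by omega)
      obtain ⟨J, haJ, hJ, hIJ⟩ := exists_card_eq_inter hI (hn ▸ hkn) (a := a) (by omega)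
      have h0 : I ∩ J = ∅ := by
        refine Finset.eq_empty_of_forall_notMem fun x hx => ?_
        have := Finset.mem_singleton.1 (hIJ hx)
        exact haI (this ▸ (Finset.mem_inter.1 hx).1)
      have h1 : p a ⊓ K.sup p ≤ g I ⊓ g J := by
        rw [inf_comm]
        refine inf_le_inf (Finset.sup_le fun i hi => hple i I hI (hKI hi)) (hple a J hJ haJ)
      have h2 := hr.mono h1
      rw [hg I J hI hJ, h0, Finset.card_empty] at h2
      have h3 := hr.modular (p a) (K.sup p)
      have h4 : r (p a) = 1 := hp1 a
      rw [Finset.sup_insert, ← ih (by omega)]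
      omega
  have hgI : ∀ I : Finset ι, I.card = k → g I = I.sup p := fun I hI =>
    (hr.eq_of_le (Finset.sup_le fun i hi => hple i I hI hi)
      (by rw [hg.rank hI, hrank I hI.le, hI])).symm
  refine ⟨fun I => I.sup p, isFrame_of_points hr hn p (fun i => (hp1 i).le) ?_, hgI⟩
  refine htop _ fun I hI => ?_
  rw [hgI I hI]
  exact Finset.sup_mono (Finset.subset_univ I)

/-- The dual rank of the new meet is `n - |Iᶜ ∪ Jᶜ| = |I ∩ J|`. This reduces `2 * k > n` to the
opposite inequality. -/
theorem IsJohnsonFamily.toDual_compl (hr : IsRank r n) (hn : Fintype.card ι = n) (hk : k ≤ n)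
    (hg : IsJohnsonFamily r k g) :
    IsJohnsonFamily (fun x : Lᵒᵈ => n - r (OrderDual.ofDual x)) (n - k)
      (fun I => OrderDual.toDual (g Iᶜ)) := by
  intro I J hI hJ
  have hc : ∀ I : Finset ι, I.card = n - k → Iᶜ.card = k := fun I hI => by
    rw [Finset.card_compl, hI, hn]
    omega
  have h1 := hg.rank_sup hr (hc I hI) (hc J hJ)
  rw [← Finset.compl_inter, Finset.card_compl, hn] at h1
  have h2 : (I ∩ J).card ≤ n := hn ▸ Finset.card_le_univ _
  change n - r (g Iᶜ ⊔ g Jᶜ) = _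
  omega

/-- Here the indices stay put, which works only for `n = 2 * k`: then `n - |I ∪ J| = |I ∩ J|`. Tops
become stars. -/
theorem IsJohnsonFamily.toDual (hr : IsRank r n) (hkn : n = 2 * k) (hg : IsJohnsonFamily r k g) :
    IsJohnsonFamily (fun x : Lᵒᵈ => n - r (OrderDual.ofDual x)) k
      (fun I => OrderDual.toDual (g I)) := by
  intro I J hI hJ
  have h1 := hg.rank_sup hr hI hJ
  have h2 := Finset.card_union_add_card_inter I J
  change n - r (g I ⊔ g J) = _
  omega

/-- The top case is the star case of the opposite lattice when `n = 2 * k`. When `2 * k < n` it is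
impossible: two members with disjoint indices would have a join of rank `2 * k` above the whole
family. -/
theorem IsJohnsonFamily.exists_frame_of_le (hr : IsRank r n) (hn : Fintype.card ι = n) (hk : 1 < k)
    (hkn : 2 * k ≤ n) (hg : IsJohnsonFamily r k g)
    (htop : ∀ x, (∀ I : Finset ι, I.card = k → g I ≤ x) → x = ⊤)
    (hbot : ∀ x, (∀ I : Finset ι, I.card = k → x ≤ g I) → x = ⊥) :
    (∃ h : Finset ι → L, IsFrame r h ∧ ∀ I : Finset ι, I.card = k → g I = h I) ∨
      (n = 2 * k ∧ ∃ h : Finset ι → L, IsFrame r h ∧ ∀ I : Finset ι, I.card = k → g I = h Iᶜ) := by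
  rcases hg.star_or_top hr hk (by omega) with hs | ht
  · exact Or.inl (hs.exists_frame hr hn hk hkn hg htop)
  · by_cases h2k : n = 2 * k
    · right
      refine ⟨h2k, ?_⟩
      obtain ⟨h, hh, hgh⟩ := IsStarFamily.exists_frame (g := fun I => OrderDual.toDual (g I))
        hr.dual hn hk hkn (hg.toDual hr h2k) ht hbot
      refine ⟨_, hh.of_dual hr hn, fun I hI => ?_⟩
      rw [compl_compl, ← hgh I hI]
      rfl
    · exfalso
      obtain ⟨I, -, hI⟩ := Finset.exists_subset_card_eq (s := (Finset.univ : Finset ι)) (n := k)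
        (by rw [Finset.card_univ]; omega)
      obtain ⟨J, hJI, hJ⟩ := Finset.exists_subset_card_eq (s := Iᶜ) (n := k)
        (by rw [Finset.card_compl]; omega)
      have h0 : I ∩ J = ∅ := by
        rw [← Finset.disjoint_iff_inter_eq_empty]
        exact disjoint_compl_right.mono_right hJI
      have hne : I ≠ J := by
        rintro rfl
        rw [Finset.inter_self] at h0
        rw [h0, Finset.card_empty] at hI
        omega
      have h1 := htop (g I ⊔ g J) fun M hM => ht.le_sup hr hg hI hJ hne hM (by simp [h0])
      have h2 := hg.rank_sup hr hI hJ
      have h3 := Finset.card_union_le I J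
      rw [h1, hr.top] at h2
      omega

/-- A Johnson family which is not contained in a proper interval comes from a frame. -/
theorem IsJohnsonFamily.exists_frame (hr : IsRank r n) (hn : Fintype.card ι = n) (hk : 1 < k)
    (hkn : k + 1 < n) (hg : IsJohnsonFamily r k g)
    (htop : ∀ x, (∀ I : Finset ι, I.card = k → g I ≤ x) → x = ⊤)
    (hbot : ∀ x, (∀ I : Finset ι, I.card = k → x ≤ g I) → x = ⊥) :
    (∃ h : Finset ι → L, IsFrame r h ∧ ∀ I : Finset ι, I.card = k → g I = h I) ∨
      (n = 2 * k ∧ ∃ h : Finset ι → L, IsFrame r h ∧ ∀ I : Finset ι, I.card = k → g I = h Iᶜ) := by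
  by_cases h2k : 2 * k ≤ n
  · exact hg.exists_frame_of_le hr hn hk h2k htop hbot
  · have hc : ∀ I : Finset ι, I.card = k → Iᶜ.card = n - k := fun I hI => by
      rw [Finset.card_compl, hI, hn]
    have key := IsJohnsonFamily.exists_frame_of_le hr.dual hn (k := n - k) (by omega) (by omega)
      (hg.toDual_compl hr hn (by omega))
      (fun x hx => hbot (OrderDual.ofDual x) fun I hI => by
        have := hx Iᶜ (hc I hI)
        rwa [compl_compl] at this)
      (fun x hx => htop (OrderDual.ofDual x) fun I hI => by
        have := hx Iᶜ (hc I hI)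
        rwa [compl_compl] at this)
    rcases key with ⟨h, hh, hgh⟩ | ⟨h1, -⟩
    · left
      refine ⟨_, hh.of_dual hr hn, fun I hI => ?_⟩
      have := hgh Iᶜ (hc I hI)
      rw [compl_compl] at this
      exact this
    · omega

end Frames
-- Distances in Johnson and Grassmann graphs
section Distance

/-- A characterization of the distance in a graph. -/
theorem dist_eq_of_step {A : Type*} (G : SimpleGraph A) (δ : A → A → ℕ)
    (hzero : ∀ x y, δ x y = 0 ↔ x = y) (hadj : ∀ x y z, G.Adj x z → δ x y ≤ δ z y + 1)
    (hstep : ∀ x y, x ≠ y → ∃ z, G.Adj x z ∧ δ z y + 1 = δ x y) (x y : A) :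
    G.Reachable x y ∧ G.dist x y = δ x y := by
  have hwalk : ∀ m x, δ x y = m → ∃ w : G.Walk x y, w.length = m := by
    intro m
    induction m with
    | zero =>
      intro x hx
      obtain rfl := (hzero x y).1 hx
      exact ⟨SimpleGraph.Walk.nil, rfl⟩
    | succ m ih =>
      intro x hx
      have hxy : x ≠ y := fun h => by
        have := (hzero x y).2 h
        omega
      obtain ⟨z, hz, hzy⟩ := hstep x y hxy
      obtain ⟨w, hw⟩ := ih z (by omega)
      exact ⟨SimpleGraph.Walk.cons hz w, by simp [hw]⟩
  have hle : ∀ {x y} (w : G.Walk x y), δ x y ≤ w.length := by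
    intro x y w
    induction w with
    | nil => simp [(hzero _ _).2 rfl]
    | cons h w ih => exact (hadj _ _ _ h).trans (by simpa using ih)
  obtain ⟨w, hw⟩ := hwalk _ x rfl
  refine ⟨w.reachable, le_antisymm (hw ▸ G.dist_le w) ?_⟩
  obtain ⟨w', hw'⟩ := w.reachable.exists_walk_length_eq_dist
  rw [← hw']
  exact hle w'

theorem johnsonGraph_dist {n k : ℕ} (I J : {X : Finset (Fin n) // X.card = k}) :
    (johnsonGraph n k).dist I J = k - (I.1 ∩ J.1).card := by
  refine (dist_eq_of_step (johnsonGraph n k) (fun I J => k - (I.1 ∩ J.1).card) ?_ ?_ ?_ I J).2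
  · intro I J
    have h1 : (I.1 ∩ J.1).card ≤ k := (Finset.card_le_card Finset.inter_subset_left).trans_eq I.2
    constructor
    · intro h
      have e1 := Finset.eq_of_subset_of_card_le (Finset.inter_subset_left (s₁ := I.1) (s₂ := J.1))
        (by rw [I.2]; omega)
      have e2 := Finset.eq_of_subset_of_card_le (Finset.inter_subset_right (s₁ := I.1) (s₂ := J.1))
        (by rw [J.2]; omega)
      exact Subtype.ext (e1.symm.trans e2)
    · rintro rfl
      simp [I.2]
  · intro I J K h
    have h1 : (I.1 ∩ K.1).card + 1 = k := h
    have h2 := Finset.card_union_add_card_inter (I.1 ∩ K.1) (K.1 ∩ J.1)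
    have h3 : ((I.1 ∩ K.1) ∪ (K.1 ∩ J.1)).card ≤ K.1.card := Finset.card_le_card
      (Finset.union_subset Finset.inter_subset_right Finset.inter_subset_left)
    have h4 : ((I.1 ∩ K.1) ∩ (K.1 ∩ J.1)).card ≤ (I.1 ∩ J.1).card := Finset.card_le_card
      (Finset.inter_subset_inter Finset.inter_subset_left Finset.inter_subset_right)
    rw [K.2] at h3
    omega
  · intro I J hIJ
    have hne : I.1 ≠ J.1 := fun h => hIJ (Subtype.ext h)
    obtain ⟨x, hx, hxJ⟩ := Finset.not_subset.1 fun h =>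
      hne (Finset.eq_of_subset_of_card_le h (by rw [I.2, J.2]))
    obtain ⟨a, ha, haI⟩ := Finset.not_subset.1 fun h =>
      hne (Finset.eq_of_subset_of_card_le h (by rw [I.2, J.2])).symm
    have ha' : a ∉ I.1.erase x := fun h => haI (Finset.mem_of_mem_erase h)
    have hc := Finset.card_erase_add_one hx
    rw [I.2] at hc
    -- Trading `x ∈ I \ J` for `a ∈ J \ I` gives a neighbour of `I` one step closer to `J`.
    refine ⟨⟨insert a (I.1.erase x), by rw [Finset.card_insert_of_notMem ha', hc]⟩, ?_, ?_⟩
    · change (I.1 ∩ insert a (I.1.erase x)).card + 1 = k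
      rw [Finset.inter_insert_of_notMem haI, Finset.inter_eq_right.2 (Finset.erase_subset _ _), hc]
    · have : insert a (I.1.erase x) ∩ J.1 = insert a (I.1 ∩ J.1) := by
        rw [Finset.insert_inter_of_mem ha, Finset.erase_inter, Finset.erase_eq_of_notMem]
        exact fun h => hxJ (Finset.mem_inter.1 h).2
      dsimp only
      rw [this, Finset.card_insert_of_notMem fun h => haI (Finset.mem_inter.1 h).1]
      have h1 : (I.1 ∩ J.1).card < k := (Finset.card_lt_card
        ⟨Finset.inter_subset_left, fun h => hxJ (Finset.mem_inter.1 (h hx)).2⟩).trans_eq I.2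
      omega

variable {R V : Type*} [DivisionRing R] [AddCommGroup V] [Module R V] [FiniteDimensional R V]

variable (R V) in
theorem isRank_finrank :
    IsRank (fun P : Submodule R V => finrank R P) (finrank R V) where
  strictMono _ _ h := Submodule.finrank_lt_finrank_of_lt h
  modular P Q := Submodule.finrank_sup_add_finrank_inf_eq P Q
  bot := finrank_bot R V
  top := finrank_top R V

theorem finrank_sup_span_singleton {P : Submodule R V} {x : V} (hx : x ∉ P) :
    finrank R (P ⊔ Submodule.span R {x} : Submodule R V) = finrank R P + 1 := by
  have hx0 : x ≠ 0 := fun h => hx (h ▸ P.zero_mem)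
  have h1 := Submodule.finrank_sup_add_finrank_inf_eq P (Submodule.span R {x})
  rw [finrank_span_singleton hx0] at h1
  have h2 : P ⊓ Submodule.span R {x} = ⊥ := by
    rw [← disjoint_iff]
    exact (Submodule.disjoint_span_singleton' hx0).2 hx
  rw [h2, finrank_bot] at h1
  exact h1

theorem exists_hyperplane_of_lt {P Q : Submodule R V} (h : P < Q) :
    ∃ H, P ≤ H ∧ H ≤ Q ∧ finrank R H + 1 = finrank R Q := by
  obtain ⟨H, h1, h2⟩ := exists_le_covBy_of_lt h
  refine ⟨H, h1, h2.le, ?_⟩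
  obtain ⟨x, hx, hxH⟩ := Set.exists_of_ssubset h2.lt
  have h3 : H ⊔ Submodule.span R {x} = Q := by
    refine (h2.eq_or_eq le_sup_left
      (sup_le h2.le ((Submodule.span_singleton_le_iff_mem _ _).2 hx))).resolve_left fun e => hxH ?_
    rw [← e]
    exact Submodule.mem_sup_right (Submodule.mem_span_singleton_self x)
  rw [← h3, finrank_sup_span_singleton hxH]

theorem grassmannGraph_dist {k : ℕ} (P Q : Gr R V k) :
    (grassmannGraph R V k).dist P Q = k - finrank R (P.1 ⊓ Q.1 : Submodule R V) := by
  have hr := isRank_finrank R V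
  have tri : ∀ P Q Z : Gr R V k, (grassmannGraph R V k).Adj P Z →
      finrank R (Z.1 ⊓ Q.1 : Submodule R V) ≤ finrank R (P.1 ⊓ Q.1 : Submodule R V) + 1 := by
    intro P Q Z h
    have h1 : finrank R (P.1 ⊓ Z.1 : Submodule R V) + 1 = k := h
    have h2 := hr.modular (P.1 ⊓ Z.1) (Z.1 ⊓ Q.1)
    have h3 := hr.mono (sup_le (inf_le_right : P.1 ⊓ Z.1 ≤ Z.1) (inf_le_left : Z.1 ⊓ Q.1 ≤ Z.1))
    have h4 := hr.mono (inf_le_inf (inf_le_left : P.1 ⊓ Z.1 ≤ P.1) (inf_le_right : Z.1 ⊓ Q.1 ≤ Q.1))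
    have h5 := Z.2
    omega
  have hlt : ∀ P Q : Gr R V k, P ≠ Q → P.1 ⊓ Q.1 < P.1 := fun P Q hPQ =>
    lt_of_le_of_ne inf_le_left fun e => hPQ <| Subtype.ext <|
      hr.eq_of_le (inf_eq_left.1 e) (by rw [P.2, Q.2])
  refine (dist_eq_of_step (grassmannGraph R V k)
    (fun P Q => k - finrank R (P.1 ⊓ Q.1 : Submodule R V)) ?_ ?_ ?_ P Q).2
  · intro P Q
    constructor
    · intro h
      by_contra hPQ
      have := hr.strictMono (hlt P Q hPQ)
      have := P.2
      omega
    · rintro rfl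
      rw [inf_idem, P.2, Nat.sub_self]
  · intro P Q Z h
    have := tri P Q Z h
    omega
  · intro P Q hPQ
    -- The neighbour of `P` closer to `Q` is a hyperplane `H` of `P` containing `P ⊓ Q`, enlarged by
    -- a vector of `Q` outside `P`.
    obtain ⟨H, h1, h2, h3⟩ := exists_hyperplane_of_lt (hlt P Q hPQ)
    obtain ⟨y, hy, hyP⟩ : ∃ y ∈ Q.1, y ∉ P.1 := by
      by_contra hcon
      push Not at hcon
      exact hPQ (Subtype.ext (hr.eq_of_le (show Q.1 ≤ P.1 from hcon) (by rw [P.2, Q.2])).symm)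
    have h4 := finrank_sup_span_singleton (fun h => hyP (h2 h) : y ∉ H)
    have hP := P.2
    obtain ⟨Z, hZ⟩ : ∃ Z : Gr R V k, Z.1 = H ⊔ Submodule.span R {y} := ⟨⟨_, by omega⟩, rfl⟩
    have h5 : (grassmannGraph R V k).Adj P Z := by
      change finrank R (P.1 ⊓ Z.1 : Submodule R V) + 1 = k
      rw [hZ]
      have e1 := hr.mono (le_inf h2 le_sup_left : H ≤ P.1 ⊓ (H ⊔ Submodule.span R {y}))
      have e2 : P.1 ⊓ (H ⊔ Submodule.span R {y}) < H ⊔ Submodule.span R {y} :=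
        lt_of_le_of_ne inf_le_right fun e => hyP
          (inf_eq_right.1 e (Submodule.mem_sup_right (Submodule.mem_span_singleton_self y)))
      have e3 := hr.strictMono e2
      omega
    refine ⟨Z, h5, ?_⟩
    have h6 := tri P Q Z h5
    have h7 : (P.1 ⊓ Q.1) ⊔ Submodule.span R {y} ≤ Z.1 ⊓ Q.1 := by
      rw [hZ]
      exact le_inf (sup_le_sup_right h1 _)
        (sup_le inf_le_right ((Submodule.span_singleton_le_iff_mem _ _).2 hy))
    have h8 := hr.mono h7
    have h9 := finrank_sup_span_singleton (fun h => hyP h.1 : y ∉ P.1 ⊓ Q.1)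
    have h10 := hr.strictMono (hlt P Q hPQ)
    omega

theorem IsIsometricEmbedding.finrank_inf {n k : ℕ}
    {g : {X : Finset (Fin n) // X.card = k} → Gr R V k}
    (hg : IsIsometricEmbedding (johnsonGraph n k) (grassmannGraph R V k) g)
    (I J : {X : Finset (Fin n) // X.card = k}) :
    finrank R ((g I).1 ⊓ (g J).1 : Submodule R V) = (I.1 ∩ J.1).card := by
  have h1 := hg.2.2 I J
  rw [johnsonGraph_dist, grassmannGraph_dist] at h1
  have h2 : (I.1 ∩ J.1).card ≤ k := (Finset.card_le_card Finset.inter_subset_left).trans_eq I.2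
  have h3 := (isRank_finrank R V).mono (inf_le_left : (g I).1 ⊓ (g J).1 ≤ (g I).1)
  have h4 := (g I).2
  omega

end Distance
-- Large subsets common to two apartments
section Complement

variable {L : Type*} [Lattice L] [BoundedOrder L] {r : L → ℕ} {n : ℕ}
  {ι : Type*} [Fintype ι] [DecidableEq ι] {k : ℕ} {h h' : Finset ι → L}

/-- The `k`-subsets which contain `a` and do not contain `b`. -/
def complementSet (k : ℕ) (a b : ι) : Finset (Finset ι) :=
  (Finset.univ.powersetCard k).filter fun I => a ∈ I ∧ b ∉ I

theorem mem_complementSet {a b : ι} {I : Finset ι} :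
    I ∈ complementSet k a b ↔ I.card = k ∧ a ∈ I ∧ b ∉ I := by
  simp [complementSet]

theorem exists_card_eq_mem_mem_notMem (hn : Fintype.card ι = n) (hk : 1 < k) (hkn : k + 1 < n)
    {a b c : ι} (hac : a ≠ c) (hbc : b ≠ c) :
    ∃ I : Finset ι, I.card = k ∧ a ∈ I ∧ b ∈ I ∧ c ∉ I := by
  have h1 : ({a, b} : Finset ι).card ≤ 2 := Finset.card_le_two
  obtain ⟨I, h2, h3, h4⟩ := exists_card_eq_of_subset_of_notMem (K := {a, b}) (a := c) (k := k)
    (by simp; exact ⟨hac.symm, hbc.symm⟩) (by omega) (by omega)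
  exact ⟨I, h4, h2 (by simp), h2 (by simp), h3⟩

theorem exists_card_eq_mem_notMem_notMem (hn : Fintype.card ι = n) (hk : 1 < k) (hkn : k + 1 < n)
    {a b c : ι} (hab : a ≠ b) (hac : a ≠ c) :
    ∃ I : Finset ι, I.card = k ∧ a ∈ I ∧ b ∉ I ∧ c ∉ I := by
  have h1 : ({b, c} : Finset ι).card ≤ 2 := Finset.card_le_two
  obtain ⟨I, h2, h3, h4⟩ := Finset.exists_subsuperset_card_eq (s := {a}) (t := {b, c}ᶜ) (n := k)
    (by simp [hab, hac]) (by simp; omega) (by rw [Finset.card_compl]; omega)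
  refine ⟨I, h4, h2 (by simp), fun h => ?_, fun h => ?_⟩
  · simpa using h3 h
  · simpa using h3 h

theorem card_complementSet (hn : Fintype.card ι = n) (hk : 1 < k) {a b : ι} (hab : a ≠ b) :
    (complementSet k a b).card = (n - 2).choose (k - 1) := by
  have h2 : (({a, b}ᶜ : Finset ι)).card = n - 2 := by
    rw [Finset.card_compl, hn, Finset.card_pair hab]
  rw [← h2, ← Finset.card_powersetCard]
  refine Finset.card_nbij' (fun I => I.erase a) (fun I => insert a I) ?_ ?_ ?_ ?_
  · intro I hI
    rw [Finset.mem_coe, mem_complementSet] at hI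
    rw [Finset.mem_coe, Finset.mem_powersetCard]
    refine ⟨fun x hx => ?_, by rw [Finset.card_erase_of_mem hI.2.1, hI.1]⟩
    rw [Finset.mem_erase] at hx
    simp only [Finset.mem_compl, Finset.mem_insert, Finset.mem_singleton, not_or]
    exact ⟨hx.1, fun e => hI.2.2 (e ▸ hx.2)⟩
  · intro I hI
    rw [Finset.mem_coe, Finset.mem_powersetCard] at hI
    rw [Finset.mem_coe, mem_complementSet]
    have ha : a ∉ I := fun h => by simpa using hI.1 h
    have hb : b ∉ I := fun h => by simpa using hI.1 h
    refine ⟨by rw [Finset.card_insert_of_notMem ha, hI.2]; omega, Finset.mem_insert_self _ _, ?_⟩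
    simp [hb, hab.symm]
  · intro I hI
    rw [Finset.mem_coe, mem_complementSet] at hI
    exact Finset.insert_erase hI.2.1
  · intro I hI
    rw [Finset.mem_coe, Finset.mem_powersetCard] at hI
    exact Finset.erase_insert fun h => by simpa using hI.1 h

variable {T : Finset (Finset ι)}

/-- If `T` contained all `k`-subsets through `m`, it would contain some `complementSet k m b`
properly, since some of these subsets also contain `b`; so `T` would be too large. -/
theorem exists_notMem_of_card_le_of_mem (hn : Fintype.card ι = n) (hk : 1 < k) (hkn : k + 1 < n)
    (hT : T.card ≤ (n - 2).choose (k - 1)) (m : ι) :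
    ∃ K : Finset ι, K.card = k ∧ m ∈ K ∧ K ∉ T := by
  by_contra hcon
  push Not at hcon
  obtain ⟨b, hb⟩ := Fintype.exists_ne_of_one_lt_card (by omega) m
  obtain ⟨c, hc⟩ : ∃ c, c ∉ ({m, b} : Finset ι) := by
    by_contra h
    push Not at h
    have h1 := Finset.card_le_two (a := m) (b := b)
    rw [Finset.eq_univ_iff_forall.2 h, Finset.card_univ] at h1
    omega
  simp only [Finset.mem_insert, Finset.mem_singleton, not_or] at hc
  obtain ⟨K, h1, h2, h3, -⟩ := exists_card_eq_mem_mem_notMem hn hk hkn (Ne.symm hc.1) (Ne.symm hc.2)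
  have h4 : complementSet k m b ⊂ T := by
    refine ⟨fun I hI => ?_, fun h => ?_⟩
    · rw [mem_complementSet] at hI
      exact hcon I hI.1 hI.2.1
    · exact (mem_complementSet.1 (h (hcon K h1 h2))).2.2 h3
  have h5 := Finset.card_lt_card h4
  rw [card_complementSet hn hk hb.symm] at h5
  omega

theorem exists_notMem_of_card_le_of_notMem (hn : Fintype.card ι = n) (hk : 1 < k) (hkn : k + 1 < n)
    (hT : T.card ≤ (n - 2).choose (k - 1)) (m : ι) :
    ∃ K : Finset ι, K.card = k ∧ m ∉ K ∧ K ∉ T := by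
  by_contra hcon
  push Not at hcon
  obtain ⟨b, hb⟩ := Fintype.exists_ne_of_one_lt_card (by omega) m
  obtain ⟨c, hc⟩ : ∃ c, c ∉ ({m, b} : Finset ι) := by
    by_contra h
    push Not at h
    have h1 := Finset.card_le_two (a := m) (b := b)
    rw [Finset.eq_univ_iff_forall.2 h, Finset.card_univ] at h1
    omega
  simp only [Finset.mem_insert, Finset.mem_singleton, not_or] at hc
  obtain ⟨K, h1, -, h2, h3⟩ := exists_card_eq_mem_notMem_notMem hn hk hkn hc.1 hc.2
  have h4 : complementSet k b m ⊂ T := by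
    refine ⟨fun I hI => ?_, fun h => ?_⟩
    · rw [mem_complementSet] at hI
      exact hcon I hI.1 hI.2.2
    · exact h3 (mem_complementSet.1 (h (hcon K h1 h2))).2.1
  have h5 := Finset.card_lt_card h4
  rw [card_complementSet hn hk hb] at h5
  omega

theorem IsFrame.eq_top_of_forall_le (hr : IsRank r n) (hn : Fintype.card ι = n) (hk : 1 < k)
    (hkn : k + 1 < n) (hh : IsFrame r h) (hT : T.card ≤ (n - 2).choose (k - 1)) {x : L}
    (hx : ∀ K : Finset ι, K.card = k → K ∉ T → h K ≤ x) : x = ⊤ := by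
  rw [eq_top_iff, ← hh.univ hr hn]
  refine hh.le_of_forall_singleton hr fun m _ => ?_
  obtain ⟨K, h1, h2, h3⟩ := exists_notMem_of_card_le_of_mem hn hk hkn hT m
  exact (hh.mono (Finset.singleton_subset_iff.2 h2)).trans (hx K h1 h3)

theorem IsFrame.eq_bot_of_forall_le (hr : IsRank r n) (hn : Fintype.card ι = n) (hk : 1 < k)
    (hkn : k + 1 < n) (hh : IsFrame r h) (hT : T.card ≤ (n - 2).choose (k - 1)) {x : L}
    (hx : ∀ K : Finset ι, K.card = k → K ∉ T → x ≤ h K) : x = ⊥ := by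
  rw [eq_bot_iff, ← hh.empty hr]
  refine hh.le_of_forall hr hn fun m _ => ?_
  obtain ⟨K, h1, h2, h3⟩ := exists_notMem_of_card_le_of_notMem hn hk hkn hT m
  exact ⟨K, h2, hx K h1 h3⟩

/-- The maximal proper subsets of an apartment which are contained in another apartment are the
complements of the sets `complementSet k c d`. -/
theorem IsFrame.eq_complementSet_or (hr : IsRank r n) (hn : Fintype.card ι = n) (hk : 1 < k)
    (hh : IsFrame r h) (hh' : IsFrame r h')
    (hT : T.card ≤ (n - 2).choose (k - 1))
    (hTh : ∀ K : Finset ι, K.card = k → K ∉ T → ∃ J : Finset ι, J.card = k ∧ h' J = h K) :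
    (∃ c d, c ≠ d ∧ T = complementSet k c d) ∨
      ∀ K : Finset ι, K.card = k → ∃ J : Finset ι, J.card = k ∧ h' J = h K := by
  by_cases hcd : ∃ c d, c ≠ d ∧ complementSet k c d ⊆ T
  · obtain ⟨c, d, h1, h2⟩ := hcd
    refine Or.inl ⟨c, d, h1, (Finset.eq_of_subset_of_card_le h2 ?_).symm⟩
    rwa [card_complementSet hn hk h1]
  · right
    -- If `T` contains no `complementSet k c d`, every ordered pair is separated by a common member.
    -- Intersecting such members over all `d` isolates `h {c}`, and the same intersection computed
    -- in the other frame shows that `h {c}` is some `h' J`.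
    have hex : ∀ c d, c ≠ d → ∃ K J : Finset ι, c ∈ K ∧ d ∉ K ∧ h' J = h K := by
      intro c d hne
      by_contra hcon
      refine hcd ⟨c, d, hne, fun K hK => ?_⟩
      rw [mem_complementSet] at hK
      by_contra hKT
      obtain ⟨J, -, hJ⟩ := hTh K hK.1 hKT
      exact hcon ⟨K, J, hK.2.1, hK.2.2, hJ⟩
    have hpt : ∀ c, ∃ J, h' J = h {c} := by
      intro c
      choose K J hK using hex c
      refine ⟨Finset.univ.filter fun y => ∀ d (hd : c ≠ d), y ∈ J d hd, le_antisymm ?_ ?_⟩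
      · refine hh.le_of_forall hr hn fun d hd => ?_
        have hne : c ≠ d := fun e => hd (by simp [e])
        refine ⟨K d hne, (hK d hne).2.1, ?_⟩
        rw [← (hK d hne).2.2]
        exact hh'.mono fun y hy => (Finset.mem_filter.1 hy).2 d hne
      · refine hh'.le_of_forall hr hn fun y hy => ?_
        simp only [Finset.mem_filter, Finset.mem_univ, true_and, not_forall] at hy
        obtain ⟨d, hne, hy⟩ := hy
        refine ⟨J d hne, hy, ?_⟩
        rw [(hK d hne).2.2]
        exact hh.mono (Finset.singleton_subset_iff.2 (hK d hne).1)
    choose P hP using hpt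
    intro K hK
    have e : h' (K.biUnion P) = h K := by
      refine le_antisymm ?_ ?_
      · refine hh'.le_of_forall_singleton hr fun j hj => ?_
        obtain ⟨c, hc, hjc⟩ := Finset.mem_biUnion.1 hj
        exact (hh'.mono (Finset.singleton_subset_iff.2 hjc)).trans
          ((hP c).trans_le (hh.mono (Finset.singleton_subset_iff.2 hc)))
      · refine hh.le_of_forall_singleton hr fun c hc => ?_
        rw [← hP c]
        exact hh'.mono (Finset.subset_biUnion_of_mem P hc)
    refine ⟨_, ?_, e⟩
    rw [← hh'.rank, e, hh.rank, hK]

/-- A permutation of the `k`-subsets which permutes the sets `complementSet k a b` preserves the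
sizes of intersections. -/
theorem card_inter_eq_of_complementSet (hn : Fintype.card ι = n) (hk : 1 < k) (hkn : k + 1 < n)
    {φ : Finset ι → Finset ι} (hφ : ∀ I : Finset ι, I.card = k → (φ I).card = k)
    (hc : ∀ a b, a ≠ b → ∃ c d, c ≠ d ∧
      ∀ I : Finset ι, I.card = k → ((a ∈ I ∧ b ∉ I) ↔ (c ∈ φ I ∧ d ∉ φ I)))
    {I J : Finset ι} (hI : I.card = k) (hJ : J.card = k) :
    (φ I ∩ φ J).card = (I ∩ J).card := by
  choose c d hcd using hc
  -- `ψ` records how `φ` permutes the sets `complementSet k a b`. An ordered pair can be recovered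
  -- from its set, so `ψ` is injective, hence bijective.
  let ψ : {p : ι × ι // p.1 ≠ p.2} → {p : ι × ι // p.1 ≠ p.2} := fun p =>
    ⟨(c p.1.1 p.1.2 p.2, d p.1.1 p.1.2 p.2), (hcd p.1.1 p.1.2 p.2).1⟩
  have hψ : ∀ p I, I.card = k → ((p.1.1 ∈ I ∧ p.1.2 ∉ I) ↔
      ((ψ p).1.1 ∈ φ I ∧ (ψ p).1.2 ∉ φ I)) := fun p => (hcd p.1.1 p.1.2 p.2).2
  have hinj : Function.Injective ψ := by
    intro p q hpq
    have h1 : ∀ I : Finset ι, I.card = k →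
        ((p.1.1 ∈ I ∧ p.1.2 ∉ I) ↔ (q.1.1 ∈ I ∧ q.1.2 ∉ I)) := fun I hI => by
      rw [hψ p I hI, hψ q I hI, hpq]
    have h2 : p.1.1 = q.1.1 := by
      by_contra hne
      obtain ⟨I, e1, e2, e3, e4⟩ := exists_card_eq_mem_notMem_notMem hn hk hkn p.2 hne
      exact e4 ((h1 I e1).1 ⟨e2, e3⟩).1
    have h3 : p.1.2 = q.1.2 := by
      by_contra hne
      obtain ⟨I, e1, e2, e3, e4⟩ := exists_card_eq_mem_mem_notMem hn hk hkn p.2 (Ne.symm hne)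
      exact ((h1 I e1).1 ⟨e2, e4⟩).2 e3
    exact Subtype.ext (Prod.ext h2 h3)
  have hsurj := Finite.surjective_of_injective hinj
  have hmem : ∀ (I J : Finset ι) (p : ι × ι), p ∈ (I ∩ J) ×ˢ (I ∪ J)ᶜ ↔
      (p.1 ∈ I ∧ p.2 ∉ I) ∧ (p.1 ∈ J ∧ p.2 ∉ J) := by
    intro I J p
    simp only [Finset.mem_product, Finset.mem_inter, Finset.mem_compl, Finset.mem_union, not_or]
    tauto
  have hne : ∀ {I J : Finset ι} {p : ι × ι}, p ∈ (I ∩ J) ×ˢ (I ∪ J)ᶜ → p.1 ≠ p.2 := by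
    intro I J p hp e
    have := (hmem I J p).1 hp
    exact this.1.2 (e ▸ this.1.1)
  -- The pairs `(a, b)` whose set contains both `I` and `J` are counted. With `m = |I ∩ J|` there
  -- are `m * (n - 2 * k + m)` of them, and this count determines `m`.
  have hcard : ((I ∩ J) ×ˢ (I ∪ J)ᶜ).card = ((φ I ∩ φ J) ×ˢ (φ I ∪ φ J)ᶜ).card := by
    refine Finset.card_bij (fun p hp => (ψ ⟨p, hne hp⟩).1) ?_ ?_ ?_
    · intro p hp
      rw [hmem] at hp ⊢
      exact ⟨(hψ ⟨p, _⟩ I hI).1 hp.1, (hψ ⟨p, _⟩ J hJ).1 hp.2⟩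
    · intro p hp q hq hpq
      exact congrArg Subtype.val (hinj (Subtype.ext hpq))
    · intro q hq
      obtain ⟨p, hp⟩ := hsurj ⟨q, hne hq⟩
      have hq' : q = (ψ p).1 := by rw [hp]
      refine ⟨p.1, ?_, hq'.symm⟩
      rw [hmem] at hq ⊢
      rw [hq'] at hq
      exact ⟨(hψ p I hI).2 hq.1, (hψ p J hJ).2 hq.2⟩
  rw [Finset.card_product, Finset.card_product, Finset.card_compl, Finset.card_compl, hn] at hcard
  have h1 := Finset.card_union_add_card_inter I J
  have h2 := Finset.card_union_add_card_inter (φ I) (φ J)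
  rw [hφ I hI, hφ J hJ] at h2
  rw [hI, hJ] at h1
  have h3 : (I ∪ J).card ≤ n := hn ▸ Finset.card_le_univ _
  have h4 : (φ I ∪ φ J).card ≤ n := hn ▸ Finset.card_le_univ _
  rcases lt_trichotomy (φ I ∩ φ J).card (I ∩ J).card with h5 | h5 | h5
  · have := Nat.mul_lt_mul_of_lt_of_le h5
      (show n - (φ I ∪ φ J).card ≤ n - (I ∪ J).card by omega) (by omega)
    omega
  · exact h5
  · have := Nat.mul_lt_mul_of_lt_of_le h5
      (show n - (I ∪ J).card ≤ n - (φ I ∪ φ J).card by omega) (by omega)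
    omega

end Complement
-- Elementary transformations of bases
section Bases

variable {R V : Type*} [DivisionRing R] [AddCommGroup V] [Module R V] [FiniteDimensional R V]
  {n : ℕ} {v w : Fin n → V}

/-- The subspace spanned by the vectors of the family `v` with indices in `I`. -/
def spanOn (R : Type*) {V : Type*} [DivisionRing R] [AddCommGroup V] [Module R V] {n : ℕ}
    (v : Fin n → V) (I : Finset (Fin n)) : Submodule R V :=
  Submodule.span R (v '' (I : Set (Fin n)))

theorem mem_spanOn {I : Finset (Fin n)} {i : Fin n} (hi : i ∈ I) : v i ∈ spanOn R v I :=
  Submodule.subset_span ⟨i, hi, rfl⟩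

theorem spanOn_le {I : Finset (Fin n)} {P : Submodule R V} (h : ∀ i ∈ I, v i ∈ P) :
    spanOn R v I ≤ P := by
  rw [spanOn, Submodule.span_le]
  rintro _ ⟨i, hi, rfl⟩
  exact h i hi

theorem isFrame_spanOn (hv : LinearIndependent R v) :
    IsFrame (fun P : Submodule R V => finrank R P) (spanOn R v) where
  sup I J := by rw [spanOn, Finset.coe_union, Set.image_union, Submodule.span_union]; rfl
  rank I := by
    have := finrank_span_eq_card (hv.comp (fun i : I => (i : Fin n)) Subtype.val_injective)
    rw [Fintype.card_coe] at this
    rw [← this, spanOn, Set.range_comp, Subtype.range_coe_subtype]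
    rfl

theorem finrank_spanOn (hv : LinearIndependent R v) (I : Finset (Fin n)) :
    finrank R (spanOn R v I) = I.card := (isFrame_spanOn hv).rank I

theorem linearIndependent_of_mem_span (hn : finrank R V = n) (hv : LinearIndependent R v)
    (h : ∀ i, v i ∈ Submodule.span R (Set.range w)) : LinearIndependent R w := by
  refine linearIndependent_of_top_le_span_of_card_eq_finrank ?_ (by rw [Fintype.card_fin, hn])
  rw [← hv.span_eq_top_of_card_eq_finrank' (by rw [Fintype.card_fin, hn]), Submodule.span_le]
  rintro _ ⟨i, rfl⟩
  exact h i

theorem linearIndependent_update (hn : finrank R V = n) (hv : LinearIndependent R v) {i : Fin n}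
    {y : V} (h : v i ∈ Submodule.span R (Set.range (Function.update v i y))) :
    LinearIndependent R (Function.update v i y) := by
  refine linearIndependent_of_mem_span hn hv fun m => ?_
  by_cases hm : m = i
  · rwa [hm]
  · exact Submodule.subset_span ⟨m, Function.update_of_ne hm _ _⟩

theorem mem_span_range_update {i m : Fin n} (hm : m ≠ i) (y : V) :
    v m ∈ Submodule.span R (Set.range (Function.update v i y)) :=
  Submodule.subset_span ⟨m, Function.update_of_ne hm _ _⟩

theorem self_mem_span_range_update (i : Fin n) (y : V) :
    y ∈ Submodule.span R (Set.range (Function.update v i y)) :=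
  Submodule.subset_span ⟨i, Function.update_self _ _ _⟩

theorem linearIndependent_transvection (hn : finrank R V = n) (hv : LinearIndependent R v)
    {i j : Fin n} (hij : i ≠ j) (c : R) :
    LinearIndependent R (Function.update v i (v i + c • v j)) := by
  refine linearIndependent_update hn hv ?_
  have h1 := Submodule.sub_mem _ (self_mem_span_range_update (R := R) (v := v) i (v i + c • v j))
    (Submodule.smul_mem _ c (mem_span_range_update hij.symm (v i + c • v j)))
  rwa [add_sub_cancel_right] at h1

theorem linearIndependent_transvection_symm (hn : finrank R V = n) (hv : LinearIndependent R v)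
    {i j : Fin n} (hij : i ≠ j) {c : R} (hc : c ≠ 0) :
    LinearIndependent R (Function.update v j (v i + c • v j)) := by
  refine linearIndependent_update hn hv ?_
  have h1 := Submodule.smul_mem _ c⁻¹ (Submodule.sub_mem _
    (self_mem_span_range_update (R := R) (v := v) j (v i + c • v j))
    (mem_span_range_update hij (v i + c • v j)))
  rwa [add_sub_cancel_left, smul_smul, inv_mul_cancel₀ hc, one_smul] at h1

theorem linearIndependent_scale (hn : finrank R V = n) (hv : LinearIndependent R v) (i : Fin n)
    {c : R} (hc : c ≠ 0) : LinearIndependent R (Function.update v i (c • v i)) := by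
  refine linearIndependent_update hn hv ?_
  have h1 := Submodule.smul_mem _ c⁻¹
    (self_mem_span_range_update (R := R) (v := v) i (c • v i))
  rwa [smul_smul, inv_mul_cancel₀ hc, one_smul] at h1

theorem spanOn_update_of_notMem {i : Fin n} {I : Finset (Fin n)} (hi : i ∉ I) (y : V) :
    spanOn R (Function.update v i y) I = spanOn R v I := by
  rw [spanOn, spanOn]
  congr 1
  refine Set.image_congr fun m hm => Function.update_of_ne (ne_of_mem_of_not_mem hm hi) _ _

theorem spanOn_update_eq (hv : LinearIndependent R v) {i : Fin n} {y : V}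
    (hw : LinearIndependent R (Function.update v i y)) {I : Finset (Fin n)}
    (hy : i ∈ I → y ∈ spanOn R v I) : spanOn R (Function.update v i y) I = spanOn R v I := by
  refine (isRank_finrank R V).eq_of_le (spanOn_le fun m hm => ?_)
    (by rw [finrank_spanOn hv, finrank_spanOn hw])
  by_cases hmi : m = i
  · subst hmi
    rw [Function.update_self]
    exact hy hm
  · rw [Function.update_of_ne hmi]
    exact mem_spanOn hm

theorem spanOn_scale (hn : finrank R V = n) (hv : LinearIndependent R v) (i : Fin n)
    {c : R} (hc : c ≠ 0) (I : Finset (Fin n)) :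
    spanOn R (Function.update v i (c • v i)) I = spanOn R v I :=
  spanOn_update_eq hv (linearIndependent_scale hn hv i hc)
    fun hi => Submodule.smul_mem _ _ (mem_spanOn hi)

theorem spanOn_transvection (hn : finrank R V = n) (hv : LinearIndependent R v)
    {i j : Fin n} (hij : i ≠ j) (c : R) {I : Finset (Fin n)} (hI : i ∈ I → j ∈ I) :
    spanOn R (Function.update v i (v i + c • v j)) I = spanOn R v I :=
  spanOn_update_eq hv (linearIndependent_transvection hn hv hij c)
    fun hi => Submodule.add_mem _ (mem_spanOn hi) (Submodule.smul_mem _ _ (mem_spanOn (hI hi)))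

/-- Both sides are generated by `v i + c • v j` and the `v m` with `m ∈ I`, `m ≠ i`. A member moved
by the transvection thus also belongs to the apartment obtained by changing `v j` instead, which
retains all old members avoiding `j`. -/
theorem spanOn_transvection_symm (hn : finrank R V = n) (hv : LinearIndependent R v)
    {i j : Fin n} (hij : i ≠ j) {c : R} (hc : c ≠ 0) {I : Finset (Fin n)} (hi : i ∈ I)
    (hj : j ∉ I) :
    spanOn R (Function.update v i (v i + c • v j)) I =
      spanOn R (Function.update v j (v i + c • v j)) (insert j (I.erase i)) := by
  refine (isRank_finrank R V).eq_of_le (spanOn_le fun m hm => ?_) ?_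
  · by_cases hmi : m = i
    · subst hmi
      rw [Function.update_self]
      have := mem_spanOn (R := R) (v := Function.update v j (v m + c • v j))
        (Finset.mem_insert_self j (I.erase m))
      rwa [Function.update_self] at this
    · rw [Function.update_of_ne hmi]
      have := mem_spanOn (R := R) (v := Function.update v j (v i + c • v j))
        (Finset.mem_insert_of_mem (b := j) (Finset.mem_erase.2 ⟨hmi, hm⟩))
      rwa [Function.update_of_ne (ne_of_mem_of_not_mem hm hj)] at this
  · rw [finrank_spanOn (linearIndependent_transvection hn hv hij c),
      finrank_spanOn (linearIndependent_transvection_symm hn hv hij hc),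
      Finset.card_insert_of_notMem fun h => hj (Finset.mem_of_mem_erase h),
      Finset.card_erase_add_one hi]

theorem exists_update_of_ne_zero (hn : finrank R V = n) {C : (Fin n → V) → Prop} {i : Fin n}
    (hscale : ∀ u, LinearIndependent R u → ∀ c : R, c ≠ 0 → C u →
      C (Function.update u i (c • u i)))
    (htrans : ∀ u, LinearIndependent R u → ∀ j, i ≠ j → ∀ c : R, C u →
      C (Function.update u i (u i + c • u j)))
    (hv : LinearIndependent R v) (hC : C v) (a : Fin n → R) (hai : a i ≠ 0) :
    LinearIndependent R (Function.update v i (∑ j, a j • v j)) ∧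
      C (Function.update v i (∑ j, a j • v j)) := by
  have key : ∀ S : Finset (Fin n), i ∉ S →
      LinearIndependent R (Function.update v i (a i • v i + ∑ j ∈ S, a j • v j)) ∧
      C (Function.update v i (a i • v i + ∑ j ∈ S, a j • v j)) := by
    intro S
    induction S using Finset.induction_on with
    | empty =>
      intro _
      rw [Finset.sum_empty, add_zero]
      exact ⟨linearIndependent_scale hn hv i hai, hscale v hv _ hai hC⟩
    | insert j S hj ih =>
      intro hi
      rw [Finset.mem_insert, not_or] at hi
      obtain ⟨h1, h2⟩ := ih hi.2
      have e : Function.update (Function.update v i (a i • v i + ∑ j ∈ S, a j • v j)) i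
          (Function.update v i (a i • v i + ∑ j ∈ S, a j • v j) i +
            a j • Function.update v i (a i • v i + ∑ j ∈ S, a j • v j) j) =
          Function.update v i (a i • v i + ∑ j ∈ insert j S, a j • v j) := by
        rw [Function.update_idem, Function.update_self, Function.update_of_ne (Ne.symm hi.1),
          Finset.sum_insert hj]
        congr 1
        abel
      have h3 := linearIndependent_transvection hn h1 hi.1 (a j)
      have h4 := htrans _ h1 j hi.1 (a j) h2
      rw [e] at h3 h4
      exact ⟨h3, h4⟩
  have h := key (Finset.univ.erase i) (Finset.notMem_erase _ _)
  rwa [Finset.add_sum_erase _ (fun j => a j • v j) (Finset.mem_univ i)] at h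

/-- Any two bases are connected by elementary transformations which do not change the vectors that
the bases have in common. -/
theorem basis_induction (hn : finrank R V = n) {C : (Fin n → V) → Prop} {T : Finset (Fin n)}
    (hscale : ∀ u, LinearIndependent R u → ∀ i, i ∉ T → ∀ c : R, c ≠ 0 → C u →
      C (Function.update u i (c • u i)))
    (htrans : ∀ u, LinearIndependent R u → ∀ i, i ∉ T → ∀ j, i ≠ j → ∀ c : R, C u →
      C (Function.update u i (u i + c • u j)))
    (hv : LinearIndependent R v) (hw : LinearIndependent R w) (hvw : ∀ i ∈ T, v i = w i)
    (hC : C v) : C w := by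
  induction hm : Tᶜ.card generalizing T v with
  | zero =>
    have : T = Finset.univ := Finset.compl_eq_empty_iff _ |>.1 (Finset.card_eq_zero.1 hm)
    have e : v = w := funext fun i => hvw i (this ▸ Finset.mem_univ i)
    exact e ▸ hC
  | succ m ih =>
    obtain ⟨i, hi⟩ : Tᶜ.Nonempty := Finset.card_pos.1 (by omega)
    have hiT := Finset.mem_compl.1 hi
    have next : ∀ u, LinearIndependent R u → (∀ i ∈ T, u i = w i) → C u →
        ∀ a : Fin n → R, ∑ j, a j • u j = w i → a i ≠ 0 → C w := by
      intro u hu huw hCu a ha hai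
      have h1 := exists_update_of_ne_zero hn (fun u hu c hc => hscale u hu i hiT c hc)
        (fun u hu j hij c => htrans u hu i hiT j hij c) hu hCu a hai
      rw [ha] at h1
      refine ih (T := insert i T) (v := Function.update u i (w i))
        (fun u hu j hj => hscale u hu j fun h => hj (Finset.mem_insert_of_mem h))
        (fun u hu j hj => htrans u hu j fun h => hj (Finset.mem_insert_of_mem h)) h1.1 ?_ h1.2 ?_
      · intro j hj
        by_cases hji : j = i
        · rw [hji, Function.update_self]
        · rw [Function.update_of_ne hji]
          exact huw j ((Finset.mem_insert.1 hj).resolve_left hji)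
      · rw [Finset.compl_insert, Finset.card_erase_of_mem hi]
        omega
    have hspan := hv.span_eq_top_of_card_eq_finrank' (by rw [Fintype.card_fin, hn])
    have hwi : w i ∈ Submodule.span R (Set.range v) := hspan ▸ Submodule.mem_top
    obtain ⟨a, ha⟩ := (Submodule.mem_span_range_iff_exists_fun R).1 hwi
    by_cases hai : a i = 0
    · obtain ⟨j, hjT, haj⟩ : ∃ j, j ∉ T ∧ a j ≠ 0 := by
        by_contra hcon
        push Not at hcon
        have h1 : w i ∈ spanOn R w T := by
          rw [← ha]
          refine Submodule.sum_mem _ fun j _ => ?_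
          by_cases hj : j ∈ T
          · rw [hvw j hj]
            exact Submodule.smul_mem _ _ (mem_spanOn hj)
          · rw [hcon j hj, zero_smul]
            exact Submodule.zero_mem _
        have h2 : spanOn R w {i} ≤ spanOn R w T := spanOn_le fun m hm => by
          rwa [Finset.mem_singleton.1 hm]
        exact hiT (Finset.singleton_subset_iff.1
          ((isFrame_spanOn hw).subset_of_le (isRank_finrank R V) h2))
      have hji : j ≠ i := fun e => haj (e ▸ hai)
      -- When `v i` does not occur in `w i`, it is made to occur: after `v j` is replaced by `v j +
      -- v i`, the coefficient at `i` becomes `-a j`, which is nonzero.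
      refine next (Function.update v j (v j + (1 : R) • v i))
        (linearIndependent_transvection hn hv hji 1) (fun m hm => ?_)
        (htrans v hv j hjT i hji 1 hC) (Function.update a i (-a j)) ?_ ?_
      · rw [Function.update_of_ne (ne_of_mem_of_not_mem hm hjT), hvw m hm]
      · rw [← ha, ← sub_eq_zero, ← Finset.sum_sub_distrib,
          Finset.sum_eq_add_of_mem i j (Finset.mem_univ _) (Finset.mem_univ _) (Ne.symm hji)]
        · rw [Function.update_self, Function.update_of_ne (Ne.symm hji), Function.update_self,
            Function.update_of_ne hji, hai]
          simp
        · intro m _ hm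
          rw [Function.update_of_ne hm.1, Function.update_of_ne hm.2, sub_self]
      · rw [Function.update_self]
        exact neg_ne_zero.2 haj
    · exact next v hv hvw hC a ha hai

end Bases
-- From apartments to a map of points
section Mappings

variable {R V : Type*} [DivisionRing R] [AddCommGroup V] [Module R V] [FiniteDimensional R V]
  {L : Type*} [Lattice L] [BoundedOrder L] {r : L → ℕ} {n k : ℕ} {F : Submodule R V → L}
  {v w : Fin n → V} {h h' : Finset (Fin n) → L}

/-- The mapping of the Grassmannian of `k`-dimensional subspaces induced by `F` sends every
apartment to the image of a Johnson family. -/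
def SendsApartmentsToJohnsonFamilies (r : L → ℕ) (n k : ℕ) (F : Submodule R V → L) : Prop :=
  ∀ v : Fin n → V, LinearIndependent R v → ∃ g : Finset (Fin n) → L, IsJohnsonFamily r k g ∧
    (fun I => F (spanOn R v I)) '' {I | I.card = k} = g '' {I | I.card = k}

/-- A Johnson family has as many members as there are `k`-subsets, so a map of the finite apartment
onto it is injective. -/
theorem SendsApartmentsToJohnsonFamilies.eq_of_eq
    (hF : SendsApartmentsToJohnsonFamilies r n k F) (hv : LinearIndependent R v)
    {I J : Finset (Fin n)} (hI : I.card = k) (hJ : J.card = k)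
    (e : F (spanOn R v I) = F (spanOn R v J)) : I = J := by
  obtain ⟨g, hg, himg⟩ := hF v hv
  have hginj : Set.InjOn g {I | I.card = k} := by
    intro I hI J hJ e
    have h1 := hg I J hI hJ
    rw [e, inf_idem, hg.rank hJ] at h1
    have h2 := Finset.eq_of_subset_of_card_le (Finset.inter_subset_left (s₁ := I) (s₂ := J))
      (by rw [← h1]; exact hI.le)
    have h3 := Finset.eq_of_subset_of_card_le (Finset.inter_subset_right (s₁ := I) (s₂ := J))
      (by rw [← h1]; exact hJ.le)
    exact h2.symm.trans h3
  have hcard := hginj.ncard_image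
  rw [← himg] at hcard
  exact Set.injOn_of_ncard_image_eq hcard (Set.toFinite _) hI hJ e

/-- Subspaces which are moved by a transvection have no common images with the new apartment. -/
theorem SendsApartmentsToJohnsonFamilies.ne_transvection (hn : finrank R V = n)
    (hF : SendsApartmentsToJohnsonFamilies r n k F) (hv : LinearIndependent R v)
    {i j : Fin n} (hij : i ≠ j) {c : R} (hc : c ≠ 0) {I J : Finset (Fin n)} (hI : I.card = k)
    (hJ : J.card = k) (hiI : i ∈ I) (hjI : j ∉ I) :
    F (spanOn R v I) ≠ F (spanOn R (Function.update v i (v i + c • v j)) J) := by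
  intro e
  by_cases hX : i ∈ J → j ∈ J
  · rw [spanOn_transvection hn hv hij c hX] at e
    have := hF.eq_of_eq hv hI hJ e
    subst this
    exact hjI (hX hiI)
  · rw [Classical.not_imp] at hX
    -- The old member and the moved one both lie in the apartment where `v j` is replaced, and `F`
    -- is injective on it.
    rw [spanOn_transvection_symm hn hv hij hc hX.1 hX.2,
      ← spanOn_update_of_notMem hjI (v i + c • v j)] at e
    have := hF.eq_of_eq (linearIndependent_transvection_symm hn hv hij hc) hI (by
      rw [Finset.card_insert_of_notMem fun h => hX.2 (Finset.mem_of_mem_erase h),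
        Finset.card_erase_add_one hX.1, hJ]) e
    exact hjI (this ▸ Finset.mem_insert_self _ _)

/-- The image of the apartment defined by `v` is the apartment of the frame `h`. -/
def MapsApartment (k : ℕ) (F : Submodule R V → L) (v : Fin n → V) (h : Finset (Fin n) → L) :
    Prop :=
  (fun I => F (spanOn R v I)) '' {I | I.card = k} = h '' {I | I.card = k}

theorem MapsApartment.exists_perm (hr : IsRank r n) (hh : IsFrame r h)
    (hm : MapsApartment k F v h) :
    ∃ φ : Finset (Fin n) → Finset (Fin n), (∀ I : Finset (Fin n), I.card = k → (φ I).card = k ∧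
      F (spanOn R v I) = h (φ I)) ∧ ∀ K : Finset (Fin n), K.card = k →
      ∃ I : Finset (Fin n), I.card = k ∧ φ I = K := by
  have h1 : ∀ I : Finset (Fin n), ∃ K : Finset (Fin n), I.card = k → K.card = k ∧
      F (spanOn R v I) = h K := by
    intro I
    by_cases hI : I.card = k
    · obtain ⟨K, hK, e⟩ := (hm ▸ Set.mem_image_of_mem _ hI :
        F (spanOn R v I) ∈ h '' {I | I.card = k})
      exact ⟨K, fun _ => ⟨hK, e.symm⟩⟩
    · exact ⟨∅, fun h => absurd h hI⟩
  choose φ hφ using h1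
  refine ⟨φ, hφ, fun K hK => ?_⟩
  obtain ⟨I, hI, e⟩ := (hm.symm ▸ Set.mem_image_of_mem _ hK :
    h K ∈ (fun I => F (spanOn R v I)) '' {I | I.card = k})
  exact ⟨I, hI, hh.injective hr ((hφ I hI).2.symm.trans e)⟩

/-- The unmoved members keep their images. By the count of `complementSet` these still have join `⊤`
and meet `⊥`, so the new Johnson family satisfies the conditions of `IsJohnsonFamily.exists_frame`.
-/
theorem SendsApartmentsToJohnsonFamilies.mapsApartment_transvection (hr : IsRank r n)
    (hn : finrank R V = n) (hk : 1 < k) (hkn : k + 1 < n)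
    (hF : SendsApartmentsToJohnsonFamilies r n k F) (hv : LinearIndependent R v)
    (hh : IsFrame r h) (hm : MapsApartment k F v h) {i j : Fin n} (hij : i ≠ j) (c : R) :
    ∃ h', IsFrame r h' ∧ MapsApartment k F (Function.update v i (v i + c • v j)) h' := by
  have hw := linearIndependent_transvection hn hv hij c
  obtain ⟨g, hg, himg⟩ := hF _ hw
  obtain ⟨φ, hφ, hsurj⟩ := hm.exists_perm hr hh
  have hT : ((complementSet k i j).image φ).card ≤ (n - 2).choose (k - 1) :=
    Finset.card_image_le.trans_eq (card_complementSet (Fintype.card_fin n) hk hij)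
  have hK : ∀ K : Finset (Fin n), K.card = k → K ∉ (complementSet k i j).image φ →
      ∃ J : Finset (Fin n), J.card = k ∧ g J = h K := by
    intro K hK hKT
    obtain ⟨I, hI, rfl⟩ := hsurj K hK
    have hX : i ∈ I → j ∈ I := fun hi => by
      by_contra hj
      exact hKT (Finset.mem_image_of_mem _ (mem_complementSet.2 ⟨hI, hi, hj⟩))
    rw [← (hφ I hI).2, ← spanOn_transvection hn hv hij c hX]
    obtain ⟨J, hJ, e⟩ := (himg ▸ Set.mem_image_of_mem _ hI :
      F (spanOn R (Function.update v i (v i + c • v j)) I) ∈ g '' {I | I.card = k})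
    exact ⟨J, hJ, e⟩
  rcases hg.exists_frame hr (Fintype.card_fin n) hk hkn
    (fun x hx => hh.eq_top_of_forall_le hr (Fintype.card_fin n) hk hkn hT fun K h1 h2 => by
      obtain ⟨J, hJ, e⟩ := hK K h1 h2
      exact e ▸ hx J hJ)
    (fun x hx => hh.eq_bot_of_forall_le hr (Fintype.card_fin n) hk hkn hT fun K h1 h2 => by
      obtain ⟨J, hJ, e⟩ := hK K h1 h2
      exact e ▸ hx J hJ) with ⟨h', hh', e⟩ | ⟨h2k, h', hh', e⟩
  · refine ⟨h', hh', himg.trans ?_⟩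
    exact Set.image_congr fun I hI => e I hI
  -- Only the set of images matters here, and for `n = 2 * k` complementation permutes the
  -- `k`-subsets.
  · refine ⟨h', hh', himg.trans ?_⟩
    have hc : ∀ I : Finset (Fin n), I.card = k → Iᶜ.card = k := fun I hI => by
      rw [Finset.card_compl, Fintype.card_fin, hI]
      omega
    ext x
    constructor
    · rintro ⟨I, hI, rfl⟩
      exact ⟨Iᶜ, hc I hI, (e I hI).symm⟩
    · rintro ⟨I, hI, rfl⟩
      exact ⟨Iᶜ, hc I hI, by rw [e _ (hc I hI), compl_compl]⟩

theorem SendsApartmentsToJohnsonFamilies.exists_mapsApartment (hr : IsRank r n)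
    (hn : finrank R V = n) (hk : 1 < k) (hkn : k + 1 < n)
    (hF : SendsApartmentsToJohnsonFamilies r n k F) (hv : LinearIndependent R v)
    (hh : IsFrame r h) (hm : MapsApartment k F v h) (hw : LinearIndependent R w) :
    ∃ h', IsFrame r h' ∧ MapsApartment k F w h' := by
  refine basis_induction hn (C := fun w => ∃ h', IsFrame r h' ∧ MapsApartment k F w h') (T := ∅)
    ?_ ?_ hv hw (by simp) ⟨h, hh, hm⟩
  · rintro u hu i - c hc ⟨h', hh', hm'⟩
    refine ⟨h', hh', ?_⟩
    rw [MapsApartment, ← hm']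
    exact Set.image_congr fun I _ => by rw [spanOn_scale hn hu i hc]
  · rintro u hu i - j hij c ⟨h', hh', hm'⟩
    exact hF.mapsApartment_transvection hr hn hk hkn hu hh' hm' hij c

/-- The family given for an apartment has the right image set but an arbitrary indexing, `φ`. A
transvection along `(a, b)` shows that `φ` carries `complementSet k a b` to a set of the same kind:
its image is what the old image apartment loses on passing to the new one. Hence `φ` preserves sizes
of intersections. -/
theorem SendsApartmentsToJohnsonFamilies.johnsonFamily (hr : IsRank r n)
    (hn : finrank R V = n) (hk : 1 < k) (hkn : k + 1 < n)
    (hF : SendsApartmentsToJohnsonFamilies r n k F)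
    (hall : ∀ v : Fin n → V, LinearIndependent R v → ∃ h, IsFrame r h ∧ MapsApartment k F v h)
    (hv : LinearIndependent R v) : IsJohnsonFamily r k (fun I => F (spanOn R v I)) := by
  obtain ⟨h, hh, hm⟩ := hall v hv
  obtain ⟨φ, hφ, hsurj⟩ := hm.exists_perm hr hh
  intro I J hI hJ
  change r (F (spanOn R v I) ⊓ F (spanOn R v J)) = _
  rw [(hφ I hI).2, (hφ J hJ).2, ← hh.inf hr, hh.rank]
  refine card_inter_eq_of_complementSet (Fintype.card_fin n) hk hkn (fun I hI => (hφ I hI).1) ?_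
    hI hJ
  intro a b hab
  obtain ⟨h', hh', hm'⟩ := hall _ (linearIndependent_transvection hn hv hab 1)
  have hT : ((complementSet k a b).image φ).card ≤ (n - 2).choose (k - 1) :=
    Finset.card_image_le.trans_eq (card_complementSet (Fintype.card_fin n) hk hab)
  have hout : ∀ K : Finset (Fin n), K.card = k → K ∉ (complementSet k a b).image φ →
      ∃ J : Finset (Fin n), J.card = k ∧ h' J = h K := by
    intro K hK hKT
    obtain ⟨I, hI, rfl⟩ := hsurj K hK
    have hX : a ∈ I → b ∈ I := fun hi => by
      by_contra hj
      exact hKT (Finset.mem_image_of_mem _ (mem_complementSet.2 ⟨hI, hi, hj⟩))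
    obtain ⟨J, hJ, e⟩ := (hm' ▸ Set.mem_image_of_mem _ hI :
      F (spanOn R (Function.update v a (v a + (1 : R) • v b)) I) ∈ h' '' {I | I.card = k})
    refine ⟨J, hJ, e.trans ?_⟩
    rw [← (hφ I hI).2, ← spanOn_transvection hn hv hab 1 hX]
  rcases hh.eq_complementSet_or hr (Fintype.card_fin n) hk hh' hT hout with ⟨c, d, hcd, e⟩ | hcon
  · refine ⟨c, d, hcd, fun I hI => ?_⟩
    have h1 : I ∈ complementSet k a b ↔ φ I ∈ complementSet k c d := by
      rw [← e]
      refine ⟨Finset.mem_image_of_mem _, fun h2 => ?_⟩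
      obtain ⟨J, hJ, e2⟩ := Finset.mem_image.1 h2
      have hJk := (mem_complementSet.1 hJ).1
      have e3 := hF.eq_of_eq hv hJk hI (by rw [(hφ J hJk).2, (hφ I hI).2, e2])
      exact e3 ▸ hJ
    rw [mem_complementSet, mem_complementSet] at h1
    have h2 := (hφ I hI).1
    tauto
  -- If the two image apartments agreed, a moved member would share its image with a member of the
  -- new apartment.
  · exfalso
    obtain ⟨I, hI, haI, hbI, -⟩ := exists_card_eq_mem_notMem_notMem (Fintype.card_fin n) hk hkn
      hab hab
    obtain ⟨J, hJ, e⟩ := hcon (φ I) (hφ I hI).1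
    rw [← (hφ I hI).2] at e
    obtain ⟨M, hM, e2⟩ := (hm'.symm ▸ Set.mem_image_of_mem _ hJ :
      h' J ∈ (fun I => F (spanOn R (Function.update v a (v a + (1 : R) • v b)) I)) ''
        {I | I.card = k})
    exact hF.ne_transvection hn hv hab one_ne_zero hI hM haI hbI (e.symm.trans e2.symm)

/-- On the apartment defined by `v` the mapping induced by `F` is the natural bijection to the
apartment of the frame `h`. -/
structure MapsBasis (r : L → ℕ) (k : ℕ) (F : Submodule R V → L) (v : Fin n → V)
    (h : Finset (Fin n) → L) : Prop where
  isFrame : IsFrame r h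
  map : ∀ I : Finset (Fin n), I.card = k → F (spanOn R v I) = h I

/-- Every apartment is mapped to an apartment, either naturally or by taking complements. -/
def SendsApartmentsToApartments (r : L → ℕ) (n k : ℕ) (F : Submodule R V → L) : Prop :=
  ∀ v : Fin n → V, LinearIndependent R v → (∃ h, MapsBasis r k F v h) ∨
    n = 2 * k ∧ ∃ h, IsFrame r h ∧ ∀ I : Finset (Fin n), I.card = k → F (spanOn R v I) = h Iᶜ

theorem SendsApartmentsToJohnsonFamilies.sendsApartmentsToApartments (hr : IsRank r n)
    (hn : finrank R V = n) (hk : 1 < k) (hkn : k + 1 < n)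
    (hF : SendsApartmentsToJohnsonFamilies r n k F)
    (hv : LinearIndependent R v) (hh : IsFrame r h) (hm : MapsApartment k F v h) :
    SendsApartmentsToApartments r n k F := by
  have hall : ∀ w : Fin n → V, LinearIndependent R w → ∃ h, IsFrame r h ∧ MapsApartment k F w h :=
    fun w hw => hF.exists_mapsApartment hr hn hk hkn hv hh hm hw
  intro w hw
  obtain ⟨h', hh', hm'⟩ := hall w hw
  have hJ : ∀ K : Finset (Fin n), K.card = k → ∃ I : Finset (Fin n), I.card = k ∧
      F (spanOn R w I) = h' K := fun K hK =>
    (hm'.symm ▸ Set.mem_image_of_mem _ hK :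
      h' K ∈ (fun I => F (spanOn R w I)) '' {I | I.card = k})
  rcases (hF.johnsonFamily hr hn hk hkn hall hw).exists_frame hr (Fintype.card_fin n) hk hkn
    (fun x hx => hh'.eq_top_of_forall_le hr (Fintype.card_fin n) hk hkn (T := ∅) (by simp)
      fun K h1 _ => by
        obtain ⟨J, hJ, e⟩ := hJ K h1
        exact e ▸ hx J hJ)
    (fun x hx => hh'.eq_bot_of_forall_le hr (Fintype.card_fin n) hk hkn (T := ∅) (by simp)
      fun K h1 _ => by
        obtain ⟨J, hJ, e⟩ := hJ K h1
        exact e ▸ hx J hJ) with ⟨h₁, hh₁, e⟩ | ⟨h2k, h₁, hh₁, e⟩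
  · exact Or.inl ⟨h₁, hh₁, e⟩
  · exact Or.inr ⟨h2k, h₁, hh₁, e⟩

/-- The point `h {i}` is the meet of the `h I` with `i ∈ I` and `l ∉ I`, for any one `l ≠ i`. It is
therefore unaffected by changes of the `l`-th base vector. -/
theorem MapsBasis.singleton_le (hr : IsRank r n) (hk : 1 < k) (hkn : k + 1 < n)
    (hm : MapsBasis r k F v h) {x : L} {i : Fin n} (l : Fin n)
    (hli : i ≠ l) (hx : ∀ I : Finset (Fin n), I.card = k → i ∈ I → l ∉ I →
      x ≤ F (spanOn R v I)) : x ≤ h {i} := by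
  refine hm.isFrame.le_of_forall hr (Fintype.card_fin n) fun d hd => ?_
  obtain ⟨I, h1, h2, h3, h4⟩ := exists_card_eq_mem_notMem_notMem (Fintype.card_fin n) hk hkn
    (show i ≠ d from fun e => hd (by simp [e])) hli
  exact ⟨I, h3, hm.map I h1 ▸ hx I h1 h2 h4⟩

theorem MapsBasis.singleton_eq (hr : IsRank r n) (hk : 1 < k) (hkn : k + 1 < n)
    (hm : MapsBasis r k F v h) (hm' : MapsBasis r k F w h') {i : Fin n} (l : Fin n)
    (hli : i ≠ l) (hvw : ∀ I : Finset (Fin n), I.card = k → i ∈ I → l ∉ I →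
      spanOn R v I = spanOn R w I) : h {i} = h' {i} := by
  refine hr.eq_of_le (hm'.singleton_le hr hk hkn l hli fun I h1 h2 h3 => ?_)
    (by rw [hm.isFrame.rank, hm'.isFrame.rank])
  rw [← hvw I h1 h2 h3, hm.map I h1]
  exact hm.isFrame.mono (Finset.singleton_subset_iff.2 h2)

theorem exists_ne_ne (hn : 2 < n) (i j : Fin n) : ∃ l, i ≠ l ∧ j ≠ l := by
  by_contra h
  push Not at h
  have h1 : (Finset.univ : Finset (Fin n)) ⊆ {i, j} := fun l _ => by
    rw [Finset.mem_insert, Finset.mem_singleton]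
    by_cases e : i = l
    · exact Or.inl e.symm
    · exact Or.inr (h l e).symm
  have h2 := (Finset.card_le_card h1).trans Finset.card_le_two
  rw [Finset.card_univ, Fintype.card_fin] at h2
  omega

/-- Unmoved members decide everything. Those avoiding `i` determine the points other than `h' {i}`,
and those containing both `i` and `j` confine `h' {i}` to the line through `h {i}` and `h {j}`. -/
theorem SendsApartmentsToApartments.mapsBasis_transvection (hr : IsRank r n)
    (hn : finrank R V = n) (hk : 1 < k) (hkn : k + 1 < n)
    (hF : SendsApartmentsToApartments r n k F)
    (hv : LinearIndependent R v) (hm : MapsBasis r k F v h) {i j : Fin n} (hij : i ≠ j) (c : R) :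
    ∃ h', MapsBasis r k F (Function.update v i (v i + c • v j)) h' ∧
      (∀ m, m ≠ i → h' {m} = h {m}) ∧ h' {i} ≤ h {i} ⊔ h {j} := by
  have hN := Fintype.card_fin n
  rcases hF _ (linearIndependent_transvection hn hv hij c) with ⟨h', hm'⟩ | ⟨-, h', hh', e⟩
  · refine ⟨h', hm', fun m hmi => hm'.singleton_eq hr hk hkn hm i hmi fun I _ _ hi =>
      spanOn_update_of_notMem hi _, ?_⟩
    rw [← hm.isFrame.sup, ← Finset.insert_eq]
    refine hm.isFrame.le_of_forall hr hN fun d hd => ?_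
    simp only [Finset.mem_insert, Finset.mem_singleton, not_or] at hd
    obtain ⟨I, h1, h2, h3, h4⟩ := exists_card_eq_mem_mem_notMem hN hk hkn
      (Ne.symm hd.1) (Ne.symm hd.2)
    refine ⟨I, h4, ?_⟩
    rw [← hm.map I h1, ← spanOn_transvection hn hv hij c fun _ => h3, hm'.map I h1]
    exact hm'.isFrame.mono (Finset.singleton_subset_iff.2 h2)
  · exfalso
    -- A change of type is impossible: members with `j ∈ I` are unmoved, so `h {j} ≤ h' Iᶜ`. These
    -- `I` can contain any given index, so `h {j}` would have rank 0.
    have h0 : h {j} ≤ h' ∅ := by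
      refine hh'.le_of_forall hr hN fun d _ => ?_
      obtain ⟨I, h1, h2, h3, h4⟩ : ∃ I : Finset (Fin n), I.card = k ∧ j ∈ I ∧ d ∈ I ∧
          (i ∈ I → j ∈ I) := by
        obtain ⟨l, hl, hl'⟩ := exists_ne_ne (by omega) j d
        obtain ⟨I, h1, h2, h3, -⟩ := exists_card_eq_mem_mem_notMem hN hk hkn hl hl'
        exact ⟨I, h1, h2, h3, fun _ => h2⟩
      refine ⟨Iᶜ, by simpa using h3, ?_⟩
      rw [← e I h1, spanOn_transvection hn hv hij c h4, hm.map I h1]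
      exact hm.isFrame.mono (Finset.singleton_subset_iff.2 h2)
    have h1 := hr.mono h0
    rw [hm.isFrame.rank, hh'.rank] at h1
    simp at h1

theorem MapsBasis.scale (hn : finrank R V = n) (hv : LinearIndependent R v)
    (hm : MapsBasis r k F v h) (i : Fin n) {c : R} (hc : c ≠ 0) :
    MapsBasis r k F (Function.update v i (c • v i)) h :=
  ⟨hm.isFrame, fun I hI => by rw [spanOn_scale hn hv i hc, hm.map I hI]⟩

theorem SendsApartmentsToApartments.exists_mapsBasis (hr : IsRank r n)
    (hn : finrank R V = n) (hk : 1 < k) (hkn : k + 1 < n)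
    (hF : SendsApartmentsToApartments r n k F)
    (hv : LinearIndependent R v) (hm : MapsBasis r k F v h) (hw : LinearIndependent R w)
    {T : Finset (Fin n)} (hvw : ∀ i ∈ T, v i = w i) :
    ∃ h', MapsBasis r k F w h' ∧ ∀ i ∈ T, h' {i} = h {i} := by
  refine basis_induction hn (T := T)
    (C := fun w => ∃ h', MapsBasis r k F w h' ∧ ∀ i ∈ T, h' {i} = h {i})
    ?_ ?_ hv hw hvw ⟨h, hm, fun _ _ => rfl⟩
  · rintro u hu i - c hc ⟨h', hm', e⟩
    exact ⟨h', hm'.scale hn hu i hc, e⟩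
  · rintro u hu i hi j hij c ⟨h', hm', e⟩
    obtain ⟨h₁, hm₁, e₁, -⟩ := hF.mapsBasis_transvection hr hn hk hkn hu hm' hij c
    exact ⟨h₁, hm₁, fun m hm => (e₁ m (ne_of_mem_of_not_mem hm hi)).trans (e m hm)⟩

theorem MapsBasis.comp_perm (hm : MapsBasis r k F v h) (σ : Equiv.Perm (Fin n)) :
    MapsBasis r k F (v ∘ σ) (fun I => h (I.map σ.toEmbedding)) where
  isFrame :=
    { sup := fun I J => by rw [Finset.map_union, hm.isFrame.sup]
      rank := fun I => by rw [hm.isFrame.rank, Finset.card_map] }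
  map I hI := by
    rw [← hm.map _ (by rw [Finset.card_map, hI]), spanOn, spanOn, Set.image_comp]
    simp

/-- A transposition of indices puts the common vector in the same position of both bases. They are
then connected by elementary changes that keep this vector and, with it, its point. -/
theorem SendsApartmentsToApartments.singleton_eq (hr : IsRank r n)
    (hn : finrank R V = n) (hk : 1 < k) (hkn : k + 1 < n)
    (hF : SendsApartmentsToApartments r n k F)
    (hv : LinearIndependent R v) (hm : MapsBasis r k F v h) (hw : LinearIndependent R w)
    (hm' : MapsBasis r k F w h') {i j : Fin n} (hij : v i = w j) : h {i} = h' {j} := by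
  have hσ := hm.comp_perm (Equiv.swap i j)
  obtain ⟨h₁, hm₁, e₁⟩ := hF.exists_mapsBasis hr hn hk hkn
    (hv.comp _ (Equiv.swap i j).injective) hσ hw (T := {j}) (by simp [hij])
  have h2 := e₁ j (Finset.mem_singleton_self j)
  obtain ⟨l, hl, -⟩ := exists_ne_ne (show 2 < n by omega) j j
  rw [← hm₁.singleton_eq hr hk hkn hm' l hl fun _ _ _ _ => rfl, h2]
  simp

/-- There is a mapping of points which induces the mapping of `k`-dimensional subspaces. -/
theorem SendsApartmentsToApartments.exists_points (hr : IsRank r n)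
    (hn : finrank R V = n) (hk : 1 < k) (hkn : k + 1 < n)
    (hF : SendsApartmentsToApartments r n k F)
    (hv : LinearIndependent R v) (hm : MapsBasis r k F v h) :
    ∃ p : V → L, (∀ w : Fin n → V, LinearIndependent R w →
        ∃ h', MapsBasis r k F w h' ∧ ∀ i, h' {i} = p (w i)) ∧
      (∀ w : Fin n → V, LinearIndependent R w → ∀ i, ∀ c : R, c ≠ 0 → p (c • w i) = p (w i)) ∧
      ∀ w : Fin n → V, LinearIndependent R w → ∀ i j, i ≠ j →
        p (w i + w j) ≤ p (w i) ⊔ p (w j) := by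
  classical
  have hex : ∀ x : V, ∃ p : L, ∀ w : Fin n → V, LinearIndependent R w → ∀ h',
      MapsBasis r k F w h' → ∀ i, w i = x → h' {i} = p := by
    intro x
    by_cases hx : ∃ w : Fin n → V, LinearIndependent R w ∧ ∃ h', MapsBasis r k F w h' ∧
      ∃ i, w i = x
    · obtain ⟨w, hw, h', hm', i, hi⟩ := hx
      exact ⟨h' {i}, fun u hu h₁ hm₁ j hj =>
        hF.singleton_eq hr hn hk hkn hu hm₁ hw hm' (hj.trans hi.symm)⟩
    -- A default for vectors to which no base assigns a point, such as `0`.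
    · exact ⟨⊥, fun w hw h' hm' i hi => absurd ⟨w, hw, h', hm', i, hi⟩ hx⟩
  choose p hp using hex
  have hall : ∀ w : Fin n → V, LinearIndependent R w → ∃ h', MapsBasis r k F w h' := fun w hw => by
    obtain ⟨h', hm', -⟩ := hF.exists_mapsBasis hr hn hk hkn hv hm hw (T := ∅) (by simp)
    exact ⟨h', hm'⟩
  refine ⟨p, fun w hw => ?_, fun w hw i c hc => ?_, fun w hw i j hij => ?_⟩
  · obtain ⟨h', hm'⟩ := hall w hw
    exact ⟨h', hm', fun i => hp _ w hw h' hm' i rfl⟩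
  · obtain ⟨h', hm'⟩ := hall w hw
    rw [← hp _ w hw h' hm' i rfl]
    exact (hp _ _ (linearIndependent_scale hn hw i hc) h' (hm'.scale hn hw i hc) i
      (Function.update_self _ _ _)).symm
  · obtain ⟨h', hm'⟩ := hall w hw
    obtain ⟨h₁, hm₁, -, e⟩ := hF.mapsBasis_transvection hr hn hk hkn hw hm' hij 1
    rw [← hp _ w hw h' hm' i rfl, ← hp _ w hw h' hm' j rfl]
    refine le_of_eq_of_le ?_ e
    refine (hp _ _ (linearIndependent_transvection hn hw hij 1) h₁ hm₁ i ?_).symm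
    rw [Function.update_self, one_smul]

end Mappings
-- The fundamental theorem of projective geometry without surjectivity
section FundamentalTheorem

variable {R V : Type*} [DivisionRing R] [AddCommGroup V] [Module R V]

theorem linearIndependent_triple_iff {x y z : V} : LinearIndependent R ![x, y, z] ↔
    ∀ a b c : R, a • x + b • y + c • z = 0 → a = 0 ∧ b = 0 ∧ c = 0 := by
  rw [Fintype.linearIndependent_iff]
  constructor
  · intro h a b c habc
    have := h ![a, b, c] (by simpa [Fin.sum_univ_three] using habc)
    exact ⟨this 0, this 1, this 2⟩
  · intro h g hg
    have := h (g 0) (g 1) (g 2) (by simpa [Fin.sum_univ_three] using hg)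
    intro i
    fin_cases i
    · exact this.1
    · exact this.2.1
    · exact this.2.2

theorem coeff_eq_of_triple {x y z : V} (h : LinearIndependent R ![x, y, z]) {a b c a' b' c' : R}
    (e : a • x + b • y + c • z = a' • x + b' • y + c' • z) : a = a' ∧ b = b' ∧ c = c' := by
  have h1 := linearIndependent_triple_iff.1 h (a - a') (b - b') (c - c') (by
    rw [← sub_eq_zero] at e
    rw [← e]
    simp only [sub_smul]
    abel)
  exact ⟨sub_eq_zero.1 h1.1, sub_eq_zero.1 h1.2.1, sub_eq_zero.1 h1.2.2⟩

theorem span_singleton_smul {a : R} (ha : a ≠ 0) (x : V) :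
    Submodule.span R {a • x} = Submodule.span R {x} :=
  Submodule.span_singleton_smul_eq ha.isUnit x

variable {R' W : Type*} [DivisionRing R'] [AddCommGroup W] [Module R' W]

/-- A mapping of points which preserves collinearity and the independence of triples. -/
structure IsPointMap (R : Type*) {V R' W : Type*} [DivisionRing R] [AddCommGroup V] [Module R V]
    [DivisionRing R'] [AddCommGroup W] [Module R' W] (p : V → Submodule R' W) : Prop where
  point : ∀ x, x ≠ 0 → ∃ y, p x = Submodule.span R' {y}
  smul : ∀ (c : R) (x : V), c ≠ 0 → x ≠ 0 → p (c • x) = p x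
  add : ∀ x y, LinearIndependent R ![x, y] → p (x + y) ≤ p x ⊔ p y
  independent : ∀ x y z, LinearIndependent R ![x, y, z] → ∀ x' y' z', p x = Submodule.span R' {x'} →
    p y = Submodule.span R' {y'} → p z = Submodule.span R' {z'} → LinearIndependent R' ![x', y', z']

variable {p : V → Submodule R' W} {e : V} {e' : W} {α : V →ₗ[R] R}

theorem pair_of_triple {x y z : V} (h : LinearIndependent R ![x, y, z]) :
    LinearIndependent R ![x, y] := by
  rw [LinearIndependent.pair_iff]
  intro s t hst
  have := linearIndependent_triple_iff.1 h s t 0 (by simpa using hst)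
  exact ⟨this.1, this.2.1⟩

/-- The condition `α e = 1` fixes an affine chart: the points off the hyperplane `ker α` are spanned
by the vectors `e + x` with `α x = 0`. -/
theorem triple_or_smul (hα : α e = 1) {x y : V} (hx : α x = 0) (hy : α y = 0) (hx0 : x ≠ 0) :
    LinearIndependent R ![e, x, y] ∨ ∃ c : R, y = c • x := by
  by_cases h : ∃ c : R, y = c • x
  · exact Or.inr h
  · left
    rw [linearIndependent_triple_iff]
    intro a b c habc
    have ha : a = 0 := by simpa [hα, hx, hy] using congrArg α habc
    subst ha
    rw [zero_smul, zero_add] at habc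
    have hc : c = 0 := by
      by_contra hc
      refine h ⟨-(c⁻¹ * b), ?_⟩
      have h1 : c⁻¹ • (b • x + c • y) = 0 := by rw [habc, smul_zero]
      rw [smul_add, smul_smul, smul_smul, inv_mul_cancel₀ hc, one_smul] at h1
      rw [neg_smul, eq_neg_iff_add_eq_zero, add_comm]
      exact h1
    subst hc
    rw [zero_smul, add_zero, smul_eq_zero] at habc
    exact ⟨rfl, habc.resolve_right hx0, rfl⟩

theorem exists_triple [FiniteDimensional R V] (hdim : 3 ≤ finrank R V) (hα : α e = 1) {x : V}
    (hx : α x = 0) (hx0 : x ≠ 0) : ∃ z, α z = 0 ∧ LinearIndependent R ![e, x, z] := by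
  have h1 : Submodule.span R (Set.range ![e, x]) ≠ ⊤ := by
    intro h
    have h2 := finrank_range_le_card (R := R) ![e, x]
    rw [Set.finrank, h, finrank_top, Fintype.card_fin] at h2
    omega
  obtain ⟨y, -, hy⟩ := SetLike.exists_of_lt (lt_top_iff_ne_top.2 h1)
  have hz : α (y - α y • e) = 0 := by simp [hα]
  refine ⟨y - α y • e, hz, (triple_or_smul hα hx hz hx0).resolve_right ?_⟩
  rintro ⟨c, hc⟩
  refine hy ?_
  rw [sub_eq_iff_eq_add.1 hc]
  exact Submodule.add_mem _ (Submodule.smul_mem _ _ (Submodule.subset_span ⟨1, rfl⟩))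
    (Submodule.smul_mem _ _ (Submodule.subset_span ⟨0, rfl⟩))

/-- The point of `e + x` lies on the line through those of `e` and `x` and differs from both,
because a third vector `z` turns each coincidence into a dependent triple. Both coefficients are
therefore nonzero, and rescaling makes the first equal to 1. -/
theorem IsPointMap.exists_lift [FiniteDimensional R V] (hdim : 3 ≤ finrank R V)
    (hp : IsPointMap R p) (hα : α e = 1) (he' : p e = Submodule.span R' {e'}) {x : V}
    (hx : α x = 0) (hx0 : x ≠ 0) :
    ∃ y, p x = Submodule.span R' {y} ∧ p (e + x) = Submodule.span R' {e' + y} := by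
  obtain ⟨z, hz, hli⟩ := exists_triple hdim hα hx hx0
  have hli' := linearIndependent_triple_iff.1 hli
  have hz0 : z ≠ 0 := by simpa using hli.ne_zero 2
  have hex : e + x ≠ 0 := by
    intro h
    have := hli' 1 1 0 (by simpa using h)
    exact one_ne_zero this.1
  obtain ⟨x', hx'⟩ := hp.point x hx0
  obtain ⟨z', hz'⟩ := hp.point z hz0
  obtain ⟨t, ht⟩ := hp.point (e + x) hex
  have ht1 := hp.add e x (pair_of_triple hli) (ht ▸ Submodule.mem_span_singleton_self t)
  rw [he', hx', ← Submodule.span_insert, Submodule.mem_span_pair] at ht1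
  obtain ⟨a, b, rfl⟩ := ht1
  have h1 : LinearIndependent R ![e + x, x, z] := linearIndependent_triple_iff.2 fun s t u h => by
    have := hli' s (s + t) u (by rw [← h]; simp only [add_smul, smul_add]; abel)
    exact ⟨this.1, by simpa [this.1] using this.2.1, this.2.2⟩
  have h2 : LinearIndependent R ![e + x, e, z] := linearIndependent_triple_iff.2 fun s t u h => by
    have := hli' (s + t) s u (by rw [← h]; simp only [add_smul, smul_add]; abel)
    exact ⟨this.2.1, by simpa [this.2.1] using this.1, this.2.2⟩
  have ha : a ≠ 0 := by
    rintro rfl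
    have := linearIndependent_triple_iff.1 (hp.independent _ _ _ h1 _ _ _ ht hx' hz') 1 (-b) 0
      (by simp only [neg_smul, smul_add, one_smul, zero_smul]; abel)
    exact one_ne_zero this.1
  have hb : b ≠ 0 := by
    rintro rfl
    have := linearIndependent_triple_iff.1 (hp.independent _ _ _ h2 _ _ _ ht he' hz') 1 (-a) 0
      (by simp only [neg_smul, smul_add, one_smul, zero_smul]; abel)
    exact one_ne_zero this.1
  refine ⟨(a⁻¹ * b) • x', ?_, ?_⟩
  · rw [span_singleton_smul (mul_ne_zero (inv_ne_zero ha) hb), hx']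
  · rw [ht, ← span_singleton_smul (inv_ne_zero ha), smul_add, smul_smul, smul_smul,
      inv_mul_cancel₀ ha, one_smul]

/-- `l` is a lift of the mapping `p` of points to the kernel of `α`. -/
def IsLift (p : V → Submodule R' W) (e : V) (e' : W) (α : V →ₗ[R] R) (l : V → W) : Prop :=
  l 0 = 0 ∧ ∀ x, α x = 0 → x ≠ 0 → p x = Submodule.span R' {l x} ∧
    p (e + x) = Submodule.span R' {e' + l x}

variable {l : V → W}

theorem IsLift.triple (hp : IsPointMap R p) (he' : p e = Submodule.span R' {e'})
    (hl : IsLift p e e' α l) {x y : V} (hx : α x = 0) (hy : α y = 0)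
    (hli : LinearIndependent R ![e, x, y]) : LinearIndependent R' ![e', l x, l y] :=
  hp.independent _ _ _ hli _ _ _ he' (hl.2 x hx (by simpa using hli.ne_zero 1)).1
    (hl.2 y hy (by simpa using hli.ne_zero 2)).1

/-- The parallelogram construction: the point of `e + x + y` lies on the line joining `e + x` to `y`
and on the line joining `e + y` to `x`. Comparing with `l (x + y) = a • l x + b • l y` gives `a = b
= 1`. -/
theorem IsLift.add_of_triple (hp : IsPointMap R p) (he' : p e = Submodule.span R' {e'})
    (hl : IsLift p e e' α l) {x y : V} (hx : α x = 0) (hy : α y = 0)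
    (hli : LinearIndependent R ![e, x, y]) : l (x + y) = l x + l y := by
  have hli1 := linearIndependent_triple_iff.1 hli
  have hli' := hl.triple hp he' hx hy hli
  have hx1 := hl.2 x hx (by simpa using hli.ne_zero 1)
  have hy1 := hl.2 y hy (by simpa using hli.ne_zero 2)
  have hxy0 : x + y ≠ 0 := fun h => by
    have := hli1 0 1 1 (by simpa using h)
    exact one_ne_zero this.2.1
  have hxy1 := hl.2 (x + y) (by simp [hx, hy]) hxy0
  have h1 : l (x + y) ∈ p x ⊔ p y := by
    refine hp.add x y ?_ (hxy1.1 ▸ Submodule.mem_span_singleton_self _)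
    rw [LinearIndependent.pair_iff]
    intro s t h
    exact (hli1 0 s t (by simpa using h)).2
  have h2 : e' + l (x + y) ∈ p (e + x) ⊔ p y := by
    refine hp.add (e + x) y ?_ ?_
    · rw [LinearIndependent.pair_iff]
      intro s t h
      have := hli1 s s t (by rw [← h, smul_add])
      exact ⟨this.1, this.2.2⟩
    · rw [add_assoc, hxy1.2]
      exact Submodule.mem_span_singleton_self _
  have h3 : e' + l (x + y) ∈ p (e + y) ⊔ p x := by
    refine hp.add (e + y) x ?_ ?_
    · rw [LinearIndependent.pair_iff]
      intro s t h
      have := hli1 s t s (by rw [← h, smul_add]; abel)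
      exact ⟨this.1, this.2.1⟩
    · rw [add_assoc, add_comm y, hxy1.2]
      exact Submodule.mem_span_singleton_self _
  rw [hx1.1, hy1.1, ← Submodule.span_insert, Submodule.mem_span_pair] at h1
  rw [hx1.2, hy1.1, ← Submodule.span_insert, Submodule.mem_span_pair] at h2
  rw [hx1.1, hy1.2, ← Submodule.span_insert, Submodule.mem_span_pair] at h3
  obtain ⟨a, b, h1⟩ := h1
  obtain ⟨c, d, h2⟩ := h2
  obtain ⟨c', d', h3⟩ := h3
  rw [← h1] at h2 h3
  have e1 := coeff_eq_of_triple hli' (a := c) (b := c) (c := d) (a' := 1) (b' := a) (c' := b) (by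
    rw [one_smul, add_assoc _ (a • l x), ← h2, smul_add])
  have e2 := coeff_eq_of_triple hli' (a := c') (b := d') (c := c') (a' := 1) (b' := a) (c' := b) (by
    rw [one_smul, add_assoc _ (a • l x), ← h3, smul_add]
    abel)
  rw [← h1, ← e1.2.1, e1.1, ← e2.2.2, e2.1, one_smul, one_smul]

/-- For proportional `x` and `c • x`, an independent `z` is added: `l (x + c • x + z)` is expanded
in two ways by the independent case and `l z` is cancelled. -/
theorem IsLift.add [FiniteDimensional R V] (hdim : 3 ≤ finrank R V) (hp : IsPointMap R p)
    (hα : α e = 1) (he' : p e = Submodule.span R' {e'})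
    (hl : IsLift p e e' α l) {x y : V} (hx : α x = 0) (hy : α y = 0) : l (x + y) = l x + l y := by
  by_cases hx0 : x = 0
  · rw [hx0, hl.1, zero_add, zero_add]
  by_cases hy0 : y = 0
  · rw [hy0, hl.1, add_zero, add_zero]
  rcases triple_or_smul hα hx hy hx0 with hli | ⟨c, rfl⟩
  · exact hl.add_of_triple hp he' hx hy hli
  · have hc : c ≠ 0 := fun h => hy0 (by rw [h, zero_smul])
    obtain ⟨z, hz, hli⟩ := exists_triple hdim hα hx hx0
    have hli1 := linearIndependent_triple_iff.1 hli
    have hxz : α (c • x + z) = 0 := by simp [hx, hz]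
    have h1 : l (x + (c • x + z)) = l x + (l (c • x) + l z) := by
      rw [hl.add_of_triple hp he' hx hxz, hl.add_of_triple hp he' hy hz]
      · exact linearIndependent_triple_iff.2 fun s t u h => by
          have := hli1 s (t * c) u (by rw [← h, mul_smul])
          exact ⟨this.1, (mul_eq_zero.1 this.2.1).resolve_right hc, this.2.2⟩
      · exact linearIndependent_triple_iff.2 fun s t u h => by
          have := hli1 s (t + u * c) u (by
            rw [← h]; simp only [add_smul, mul_smul, smul_add]; abel)
          exact ⟨this.1, by simpa [this.2.2] using this.2.1, this.2.2⟩
    rw [← add_assoc, ← add_assoc] at h1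
    -- If `x + c • x = 0`, it cannot be paired with `z` in an independent triple, but then the
    -- identity already cancels.
    by_cases hc1 : 1 + c = 0
    · have h2 : x + c • x = 0 := by
        have : x + c • x = (1 + c) • x := by rw [add_smul, one_smul]
        rw [this, hc1, zero_smul]
      rw [h2, zero_add] at h1
      rw [h2, hl.1]
      exact (add_eq_right.1 h1.symm).symm
    · rw [hl.add_of_triple hp he' (by simp [hx]) hz] at h1
      · exact add_right_cancel h1
      · exact linearIndependent_triple_iff.2 fun s t u h => by
          have := hli1 s (t * (1 + c)) u (by
            rw [← h, mul_smul, add_smul, one_smul])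
          exact ⟨this.1, (mul_eq_zero.1 this.2.1).resolve_right hc1, this.2.2⟩

theorem IsLift.ne_zero [FiniteDimensional R V] (hdim : 3 ≤ finrank R V) (hp : IsPointMap R p)
    (hα : α e = 1) (he' : p e = Submodule.span R' {e'})
    (hl : IsLift p e e' α l) {x : V} (hx : α x = 0) (hx0 : x ≠ 0) : l x ≠ 0 := by
  obtain ⟨z, hz, hli⟩ := exists_triple hdim hα hx hx0
  simpa using (hl.triple hp he' hx hz hli).ne_zero 1

theorem IsLift.exists_smul (hp : IsPointMap R p) (hl : IsLift p e e' α l) (c : R) {x : V}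
    (hx : α x = 0) (hx0 : x ≠ 0) : ∃ a : R', l (c • x) = a • l x := by
  by_cases hc : c = 0
  · exact ⟨0, by rw [hc, zero_smul, hl.1, zero_smul]⟩
  · have h1 := (hl.2 (c • x) (by simp [hx]) (smul_ne_zero hc hx0)).1
    rw [hp.smul c x hc hx0, (hl.2 x hx hx0).1] at h1
    obtain ⟨a, ha⟩ := Submodule.mem_span_singleton.1
      (h1 ▸ Submodule.mem_span_singleton_self (l (c • x)) :
        l (c • x) ∈ Submodule.span R' {l x})
    exact ⟨a, ha.symm⟩

/-- Expanding `l (c • (x + y))` in two ways shows that independent directions `x` and `y` have the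
same factor; this makes `σ c` independent of the vector. -/
theorem IsLift.smul_eq_of_triple (hp : IsPointMap R p) (he' : p e = Submodule.span R' {e'})
    (hl : IsLift p e e' α l) (c : R) {x y : V} (hx : α x = 0) (hy : α y = 0)
    (hli : LinearIndependent R ![e, x, y]) {a : R'} (ha : l (c • x) = a • l x) :
    l (c • y) = a • l y := by
  have hli1 := linearIndependent_triple_iff.1 hli
  have hli' := hl.triple hp he' hx hy hli
  have hy0 : y ≠ 0 := by simpa using hli.ne_zero 2
  by_cases hc : c = 0
  · subst hc
    have hx1 : l x ≠ 0 := by simpa using hli'.ne_zero 1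
    rw [zero_smul, hl.1] at ha ⊢
    rw [(smul_eq_zero.1 ha.symm).resolve_right hx1, zero_smul]
  · have hxy0 : x + y ≠ 0 := fun h => by
      have := hli1 0 1 1 (by simpa using h)
      exact one_ne_zero this.2.1
    obtain ⟨b, hb⟩ := hl.exists_smul hp c hy hy0
    obtain ⟨d, hd⟩ := hl.exists_smul hp c (show α (x + y) = 0 by simp [hx, hy]) hxy0
    rw [smul_add, hl.add_of_triple hp he' (by simp [hx]) (by simp [hy]),
      hl.add_of_triple hp he' hx hy hli, ha, hb] at hd
    · have := coeff_eq_of_triple hli' (a := 0) (b := a) (c := b) (a' := 0) (b' := d) (c' := d) (by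
        rw [zero_smul, zero_add, zero_add, hd, smul_add])
      rw [hb, this.2.2, this.2.1]
    · exact linearIndependent_triple_iff.2 fun s t u h => by
        have := hli1 s (t * c) (u * c) (by rw [← h, mul_smul, mul_smul])
        exact ⟨this.1, (mul_eq_zero.1 this.2.1).resolve_right hc,
          (mul_eq_zero.1 this.2.2).resolve_right hc⟩

theorem IsLift.exists_ringHom [FiniteDimensional R V] (hdim : 3 ≤ finrank R V)
    (hp : IsPointMap R p) (hα : α e = 1) (he' : p e = Submodule.span R' {e'})
    (hl : IsLift p e e' α l) : ∃ σ : R →+* R', ∀ (c : R) (x : V), α x = 0 →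
      l (c • x) = σ c • l x := by
  obtain ⟨x₀, hx₀, hx₀0⟩ : ∃ x₀, α x₀ = 0 ∧ x₀ ≠ 0 := by
    have h1 : Submodule.span R {e} ≠ ⊤ := by
      intro h
      have h2 := finrank_span_le_card (R := R) ({e} : Set V)
      rw [h, finrank_top] at h2
      simp at h2
      omega
    obtain ⟨y, -, hy⟩ := SetLike.exists_of_lt (lt_top_iff_ne_top.2 h1)
    refine ⟨y - α y • e, by simp [hα], fun h => hy ?_⟩
    rw [sub_eq_zero.1 h]
    exact Submodule.smul_mem _ _ (Submodule.mem_span_singleton_self e)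
  have hne : l x₀ ≠ 0 := hl.ne_zero hdim hp hα he' hx₀ hx₀0
  choose σ hσ using fun c => hl.exists_smul hp c hx₀ hx₀0
  have key : ∀ (c : R) (x : V), α x = 0 → l (c • x) = σ c • l x := by
    intro c x hx
    by_cases hx0 : x = 0
    · rw [hx0, smul_zero, hl.1, smul_zero]
    rcases triple_or_smul hα hx₀ hx hx₀0 with hli | ⟨d, rfl⟩
    · exact hl.smul_eq_of_triple hp he' c hx₀ hx hli (hσ c)
    -- A multiple of `x₀` is compared with `x₀` through a vector `z` independent of both.
    · obtain ⟨z, hz, hli⟩ := exists_triple hdim hα hx hx0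
      have hd : d ≠ 0 := fun h => hx0 (by rw [h, zero_smul])
      have hli1 := linearIndependent_triple_iff.1 hli
      have h1 := hl.smul_eq_of_triple hp he' c hx₀ hz
        (linearIndependent_triple_iff.2 fun s t u h => by
          have := hli1 s (t * d⁻¹) u (by
            rw [← h, smul_smul, mul_assoc, inv_mul_cancel₀ hd, mul_one])
          exact ⟨this.1, (mul_eq_zero.1 this.2.1).resolve_right (inv_ne_zero hd), this.2.2⟩) (hσ c)
      exact hl.smul_eq_of_triple hp he' c hz hx
        (linearIndependent_triple_iff.2 fun s t u h => by
          have := hli1 s u t (by rw [← h, add_right_comm])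
          exact ⟨this.1, this.2.2, this.2.1⟩) h1
  have cancel : ∀ {a b : R'}, a • l x₀ = b • l x₀ → a = b := fun h =>
    smul_left_injective R' hne h
  refine ⟨{ toFun := σ, map_one' := ?_, map_mul' := ?_, map_zero' := ?_, map_add' := ?_ }, key⟩
  · exact cancel (by rw [← key 1 x₀ hx₀, one_smul, one_smul])
  · intro a b
    refine cancel ?_
    rw [← key (a * b) x₀ hx₀, mul_smul, key a _ (by simp [hx₀]), key b x₀ hx₀, mul_smul]
  · exact cancel (by rw [← key 0 x₀ hx₀, zero_smul, zero_smul, hl.1])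
  · intro a b
    refine cancel ?_
    rw [← key (a + b) x₀ hx₀, add_smul, hl.add hdim hp hα he' (by simp [hx₀]) (by simp [hx₀]),
      key a x₀ hx₀, key b x₀ hx₀, add_smul]

/-- The fundamental theorem of projective geometry for mappings which are not assumed to be
surjective. -/
theorem IsPointMap.exists_semilinearMap [FiniteDimensional R V] (hdim : 3 ≤ finrank R V)
    (hp : IsPointMap R p) : ∃ (σ : R →+* R') (l : V →ₛₗ[σ] W),
      ∀ x, x ≠ 0 → p x = Submodule.span R' {l x} := by
  classical
  have : Nontrivial V := Module.nontrivial_of_finrank_pos (R := R) (by omega)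
  let b := Module.finBasis R V
  have : Nonempty (Fin (finrank R V)) := ⟨⟨0, by omega⟩⟩
  obtain ⟨i⟩ := this
  set e := b i
  set α : V →ₗ[R] R := b.coord i
  have hα : α e = 1 := by simp [α, e]
  obtain ⟨e', he'⟩ := hp.point e (b.ne_zero i)
  have hex : ∀ x, ∃ y, (x = 0 → y = 0) ∧ (α x = 0 → x ≠ 0 → p x = Submodule.span R' {y} ∧
      p (e + x) = Submodule.span R' {e' + y}) := by
    intro x
    by_cases hx0 : x = 0
    · exact ⟨0, fun _ => rfl, fun _ h => absurd hx0 h⟩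
    by_cases hx : α x = 0
    · obtain ⟨y, hy⟩ := hp.exists_lift hdim hα he' hx hx0
      exact ⟨y, fun h => absurd h hx0, fun _ _ => hy⟩
    · exact ⟨0, fun _ => rfl, fun h => absurd h hx⟩
  choose l hl0 hl1 using hex
  have hl : IsLift p e e' α l := ⟨hl0 0 rfl, hl1⟩
  obtain ⟨σ, hσ⟩ := hl.exists_ringHom hdim hp hα he'
  have hπ : ∀ x, α (x - α x • e) = 0 := fun x => by simp [hα]
  -- The lift on `ker α` is extended along `e`; off the hyperplane, the factor `α x` is divided out
  -- to return to the chart.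
  refine ⟨σ, { toFun := fun x => σ (α x) • e' + l (x - α x • e), map_add' := ?_, map_smul' := ?_ },
    ?_⟩
  · intro x y
    have : x + y - α (x + y) • e = (x - α x • e) + (y - α y • e) := by
      rw [map_add, add_smul]
      abel
    rw [this, hl.add hdim hp hα he' (hπ x) (hπ y), map_add, map_add, add_smul]
    abel
  · intro c x
    have : c • x - α (c • x) • e = c • (x - α x • e) := by
      rw [map_smul, smul_sub, smul_smul, smul_eq_mul]
    rw [this, hσ c _ (hπ x), map_smul, smul_eq_mul, map_mul, mul_smul, smul_add]
  · intro x hx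
    change p x = Submodule.span R' {σ (α x) • e' + l (x - α x • e)}
    by_cases hαx : α x = 0
    · rw [hαx, map_zero, zero_smul, zero_add, zero_smul, sub_zero]
      exact (hl.2 x hαx hx).1
    · have h1 : x = α x • (e + (α x)⁻¹ • (x - α x • e)) := by
        rw [smul_add, smul_smul, mul_inv_cancel₀ hαx, one_smul, add_sub_cancel]
      have h2 : e + (α x)⁻¹ • (x - α x • e) ≠ 0 := fun h => hx (by rw [h1, h, smul_zero])
      have hσx : σ (α x) ≠ 0 := (map_ne_zero σ).2 hαx
      have h3 : p x = p (e + (α x)⁻¹ • (x - α x • e)) := by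
        conv_lhs => rw [h1]
        exact hp.smul _ _ hαx h2
      have h4 : p (e + (α x)⁻¹ • (x - α x • e)) =
          Submodule.span R' {e' + l ((α x)⁻¹ • (x - α x • e))} := by
        by_cases h5 : (α x)⁻¹ • (x - α x • e) = 0
        · rw [h5, add_zero, hl.1, add_zero, he']
        · exact (hl.2 _ (by rw [map_smul, hπ, smul_zero]) h5).2
      rw [h3, h4, ← span_singleton_smul hσx, smul_add, hσ _ _ (hπ x), smul_smul, map_inv₀,
        mul_inv_cancel₀ hσx, one_smul]

end FundamentalTheorem
-- The semilinear embedding of a mapping of natural type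
section Embeddings

variable {R V : Type*} [DivisionRing R] [AddCommGroup V] [Module R V] [FiniteDimensional R V]
  {n k : ℕ}

theorem exists_basis_extending (hn : finrank R V = n) {m : ℕ} {u : Fin m → V}
    (hu : LinearIndependent R u) (hm : m ≤ n) :
    ∃ w : Fin n → V, LinearIndependent R w ∧ ∀ i, w (Fin.castLE hm i) = u i := by
  induction hd : n - m generalizing m with
  | zero =>
    obtain rfl : m = n := by omega
    exact ⟨u, hu, fun i => rfl⟩
  | succ d ih =>
    obtain ⟨x, hx⟩ := exists_linearIndependent_snoc_of_lt_finrank hu (by omega)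
    obtain ⟨w, hw, h⟩ := ih hx (by omega) (by omega)
    refine ⟨w, hw, fun i => ?_⟩
    have := h (Fin.castSucc i)
    rw [Fin.snoc_castSucc] at this
    exact this

theorem exists_eq_spanOn (hn : finrank R V = n) (P : Submodule R V) :
    ∃ (w : Fin n → V) (I : Finset (Fin n)), LinearIndependent R w ∧ P = spanOn R w I := by
  have hm : finrank R P ≤ n := hn ▸ Submodule.finrank_le P
  let b := finBasis R P
  have hu : LinearIndependent R (fun i => (b i : V)) :=
    b.linearIndependent.map' P.subtype P.ker_subtype
  obtain ⟨w, hw, h⟩ := exists_basis_extending hn hu hm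
  refine ⟨w, Finset.univ.map (Fin.castLEEmb hm), hw, ?_⟩
  refine ((isRank_finrank R V).eq_of_le (spanOn_le fun i hi => ?_) ?_).symm
  · obtain ⟨j, -, rfl⟩ := Finset.mem_map.1 hi
    exact (h j).symm ▸ (b j).2
  · rw [finrank_spanOn hw, Finset.card_map, Finset.card_univ, Fintype.card_fin]

theorem exists_finrank_eq (hk : k ≤ finrank R V) : ∃ P : Submodule R V, finrank R P = k := by
  obtain ⟨I, -, hI⟩ := Finset.exists_subset_card_eq
    (s := (Finset.univ : Finset (Fin (finrank R V)))) (n := k) (by simpa using hk)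
  exact ⟨_, (finrank_spanOn (finBasis R V).linearIndependent I).trans hI⟩

theorem exists_eq_span_singleton {P : Submodule R V} (hP : finrank R P = 1) :
    ∃ y, P = Submodule.span R {y} := by
  obtain ⟨y, hy, hy0⟩ : ∃ y ∈ P, y ≠ 0 := Submodule.exists_mem_ne_zero_of_ne_bot fun h => by
    rw [h, finrank_bot] at hP
    exact zero_ne_one hP
  refine ⟨y, ((isRank_finrank R V).eq_of_le
    ((Submodule.span_singleton_le_iff_mem _ _).2 hy) ?_).symm⟩
  rw [finrank_span_singleton hy0, hP]

variable {R' W : Type*} [DivisionRing R'] [AddCommGroup W] [Module R' W] [FiniteDimensional R' W]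

/-- The span of the vectors contains the frame element on their indices, whose rank is the number of
vectors. Applied to full bases, this upgrades independence of triples to the embedding property. -/
theorem IsFrame.linearIndependent {h : Finset (Fin n) → Submodule R' W}
    (hh : IsFrame (fun P : Submodule R' W => finrank R' P) h) {κ : Type*} [Fintype κ]
    {j : κ → Fin n} (hj : Function.Injective j) {y : κ → W}
    (hy : ∀ a, h {j a} = Submodule.span R' {y a}) : LinearIndependent R' y := by
  rw [linearIndependent_iff_card_eq_finrank_span]
  refine le_antisymm ?_ (finrank_range_le_card y)
  have h1 : h (Finset.univ.map ⟨j, hj⟩) ≤ Submodule.span R' (Set.range y) := by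
    refine hh.le_of_forall_singleton (isRank_finrank R' W) fun i hi => ?_
    obtain ⟨a, -, rfl⟩ := Finset.mem_map.1 hi
    change h {j a} ≤ _
    rw [hy a]
    exact Submodule.span_mono (Set.singleton_subset_iff.2 ⟨a, rfl⟩)
  have h2 := (isRank_finrank R' W).mono h1
  rw [hh.rank, Finset.card_map] at h2
  exact h2

/-- A mapping which sends apartments to apartments, and is natural on one of them, is induced by a
semilinear embedding. -/
theorem SendsApartmentsToApartments.exists_semilinearEmbedding (hn : finrank R V = n)
    (hW : finrank R' W = n) (hk : 1 < k) (hkn : k + 1 < n) {F : Submodule R V → Submodule R' W}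
    (hF : SendsApartmentsToApartments (fun P : Submodule R' W => finrank R' P) n k F)
    {v : Fin n → V} (hv : LinearIndependent R v) {h : Finset (Fin n) → Submodule R' W}
    (hm : MapsBasis (fun P : Submodule R' W => finrank R' P) k F v h) :
    ∃ (σ : R →+* R') (l : V →ₛₗ[σ] W), IsSemilinearEmbedding l ∧
      ∀ P : Submodule R V, finrank R P = k → F P = Submodule.span R' (l '' (P : Set V)) := by
  have hr : IsRank (fun P : Submodule R' W => finrank R' P) n := hW ▸ isRank_finrank R' W
  obtain ⟨p, hp1, hp2, hp3⟩ := hF.exists_points hr hn hk hkn hv hm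
  have hone : ∀ x : V, x ≠ 0 → ∃ w : Fin n → V, LinearIndependent R w ∧ ∃ i, w i = x := by
    intro x hx
    obtain ⟨w, hw, h⟩ := exists_basis_extending hn (u := ![x])
      (LinearIndependent.of_subsingleton (v := ![x]) 0 hx) (by omega)
    exact ⟨w, hw, _, h 0⟩
  have hrank : ∀ x : V, x ≠ 0 → finrank R' (p x) = 1 := by
    intro x hx
    obtain ⟨w, hw, i, rfl⟩ := hone x hx
    obtain ⟨h', hm', e⟩ := hp1 w hw
    have := hm'.isFrame.rank {i}
    rwa [e] at this
  have hpm : IsPointMap R p := by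
    refine ⟨fun x hx => exists_eq_span_singleton (hrank x hx), fun c x hc hx => ?_,
      fun x y hxy => ?_, fun x y z hxyz x' y' z' hx' hy' hz' => ?_⟩
    · obtain ⟨w, hw, i, rfl⟩ := hone x hx
      exact hp2 w hw i c hc
    · obtain ⟨w, hw, h⟩ := exists_basis_extending hn hxy (by omega)
      have h1 := hp3 w hw (Fin.castLE (by omega) (0 : Fin 2)) (Fin.castLE (by omega) (1 : Fin 2))
        (fun e => by simpa using congrArg Fin.val e)
      rw [h 0, h 1] at h1
      exact h1
    · obtain ⟨w, hw, h⟩ := exists_basis_extending hn hxyz (by omega)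
      obtain ⟨h', hm', e⟩ := hp1 w hw
      refine hm'.isFrame.linearIndependent (j := Fin.castLE (by omega))
        (Fin.castLE_injective _) fun a => ?_
      rw [e, h]
      fin_cases a
      · exact hx'
      · exact hy'
      · exact hz'
  obtain ⟨σ, l, hl⟩ := hpm.exists_semilinearMap (by omega)
  have hl0 : ∀ x, l x = 0 → x = 0 := by
    intro x hx
    by_contra hx0
    have h1 := hrank x hx0
    rw [hl x hx0, hx, Submodule.span_zero_singleton, finrank_bot] at h1
    exact zero_ne_one h1
  refine ⟨σ, l, ⟨(injective_iff_map_eq_zero l).2 hl0, ?_⟩, fun P hP => ?_⟩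
  · rw [hn]
    intro u hu
    obtain ⟨h', hm', e⟩ := hp1 u hu
    exact hm'.isFrame.linearIndependent (j := id) Function.injective_id
      fun a => (e a).trans (hl _ (hu.ne_zero a))
  · obtain ⟨w, I, hw, rfl⟩ := exists_eq_spanOn hn P
    rw [finrank_spanOn hw] at hP
    obtain ⟨h', hm', e⟩ := hp1 w hw
    have e' : ∀ i, h' {i} = Submodule.span R' {l (w i)} := fun i =>
      (e i).trans (hl _ (hw.ne_zero i))
    rw [hm'.map I hP]
    refine le_antisymm (hm'.isFrame.le_of_forall_singleton hr fun i hi => ?_) ?_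
    · rw [e' i]
      exact Submodule.span_mono (Set.singleton_subset_iff.2 ⟨w i, mem_spanOn hi, rfl⟩)
    · rw [Submodule.span_le]
      rintro _ ⟨x, hx, rfl⟩
      have h1 : spanOn R w I ≤ (h' I).comap l := spanOn_le fun i hi => by
        refine hm'.isFrame.mono (Finset.singleton_subset_iff.2 hi) ?_
        rw [e' i]
        exact Submodule.mem_span_singleton_self _
      exact h1 hx

end Embeddings

/-! ### Annihilators and the dual space over the opposite division ring -/

section DualSpace

variable {R V : Type*} [DivisionRing R] [AddCommGroup V] [Module R V] [FiniteDimensional R V]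
  {n k : ℕ}

/-- The linear functionals which vanish on the subspace `U`. -/
def dualAnnihilator (U : Submodule R V) : Submodule Rᵐᵒᵖ (Dual R V) where
  carrier := {φ | ∀ x ∈ U, φ x = 0}
  add_mem' {φ ψ} hφ hψ x hx := by simp [hφ x hx, hψ x hx]
  zero_mem' _ _ := rfl
  smul_mem' a φ hφ x hx := by simp [hφ x hx]

/-- A scalar acts on a functional by multiplying its values on the right, hence the opposite ring.
-/
theorem sum_coord_smul (b : Basis (Fin n) R V) (φ : Dual R V) :
    ∑ i, MulOpposite.op (φ (b i)) • (b.coord i : Dual R V) = φ := by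
  refine LinearMap.ext fun x => ?_
  conv_rhs => rw [← b.sum_repr x, map_sum]
  rw [LinearMap.sum_apply]
  refine Finset.sum_congr rfl fun i _ => ?_
  simp

theorem linearIndependent_coord (b : Basis (Fin n) R V) :
    LinearIndependent Rᵐᵒᵖ (fun i => (b.coord i : Dual R V)) := by
  rw [Fintype.linearIndependent_iff]
  intro g hg j
  have h1 := LinearMap.congr_fun hg (b j)
  rw [LinearMap.sum_apply, Finset.sum_eq_single j] at h1
  · simpa using h1
  · intro i _ hij
    simp [Finsupp.single_eq_of_ne hij]
  · exact fun h => absurd (Finset.mem_univ j) h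

theorem span_coord (b : Basis (Fin n) R V) :
    Submodule.span Rᵐᵒᵖ (Set.range fun i => (b.coord i : Dual R V)) = ⊤ := by
  rw [eq_top_iff]
  intro φ _
  rw [← sum_coord_smul b φ]
  exact Submodule.sum_mem _ fun i _ => Submodule.smul_mem _ _ (Submodule.subset_span ⟨i, rfl⟩)

instance finiteDimensional_dual : FiniteDimensional Rᵐᵒᵖ (Dual R V) :=
  Module.Finite.of_basis
    (Basis.mk (linearIndependent_coord (finBasis R V)) (span_coord (finBasis R V)).ge)

variable (R V) in
theorem finrank_dual : finrank Rᵐᵒᵖ (Dual R V) = finrank R V := by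
  rw [finrank_eq_card_basis
    (Basis.mk (linearIndependent_coord (finBasis R V)) (span_coord (finBasis R V)).ge),
    Fintype.card_fin]

theorem dualAnnihilator_spanOn (b : Basis (Fin n) R V) (I : Finset (Fin n)) :
    dualAnnihilator (spanOn R b I) = spanOn Rᵐᵒᵖ (fun i => (b.coord i : Dual R V)) Iᶜ := by
  refine le_antisymm (fun φ hφ => ?_) (spanOn_le fun i hi => ?_)
  · rw [← sum_coord_smul b φ]
    refine Submodule.sum_mem _ fun i _ => ?_
    by_cases hi : i ∈ I
    · rw [hφ _ (mem_spanOn hi), MulOpposite.op_zero, zero_smul]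
      exact Submodule.zero_mem _
    · exact Submodule.smul_mem _ _
        (mem_spanOn (v := fun i => (b.coord i : Dual R V)) (Finset.mem_compl.2 hi))
  · have h1 : spanOn R b I ≤ LinearMap.ker (b.coord i) := spanOn_le fun j hj => by
      have hij : j ≠ i := ne_of_mem_of_not_mem hj (Finset.mem_compl.1 hi)
      simp [Finsupp.single_eq_of_ne hij.symm]
    exact fun x hx => h1 hx

theorem exists_basis_eq_spanOn (U : Submodule R V) :
    ∃ (b : Basis (Fin (finrank R V)) R V) (I : Finset (Fin (finrank R V))),
      U = spanOn R b I := by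
  obtain ⟨w, I, hw, rfl⟩ := exists_eq_spanOn (R := R) (V := V) rfl U
  refine ⟨Basis.mk hw (hw.span_eq_top_of_card_eq_finrank' (by simp)).ge, I, ?_⟩
  rw [Basis.coe_mk]

theorem finrank_dualAnnihilator (U : Submodule R V) :
    finrank Rᵐᵒᵖ (dualAnnihilator U) + finrank R U = finrank R V := by
  obtain ⟨b, I, rfl⟩ := exists_basis_eq_spanOn U
  have h1 := Finset.card_compl_add_card I
  rw [Fintype.card_fin] at h1
  rw [dualAnnihilator_spanOn, finrank_spanOn (linearIndependent_coord b),
    finrank_spanOn b.linearIndependent, h1]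

theorem annihilator_dualAnnihilator (U : Submodule R V) : annihilator (dualAnnihilator U) = U := by
  refine le_antisymm (fun x hx => ?_) fun x hx φ hφ => hφ x hx
  obtain ⟨b, I, rfl⟩ := exists_basis_eq_spanOn U
  rw [← b.sum_repr x]
  refine Submodule.sum_mem _ fun i _ => ?_
  by_cases hi : i ∈ I
  · exact Submodule.smul_mem _ _ (mem_spanOn hi)
  · have h1 : b.coord i x = 0 := hx _ (by
      rw [dualAnnihilator_spanOn]
      exact mem_spanOn (v := fun i => (b.coord i : Dual R V)) (Finset.mem_compl.2 hi))
    rw [Basis.coord_apply] at h1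
    rw [h1, zero_smul]
    exact Submodule.zero_mem _

theorem dualAnnihilator_anti {U U' : Submodule R V} (h : U ≤ U') :
    dualAnnihilator U' ≤ dualAnnihilator U := fun _ hφ x hx => hφ x (h hx)

theorem dualAnnihilator_sup (U U' : Submodule R V) :
    dualAnnihilator (U ⊔ U') = dualAnnihilator U ⊓ dualAnnihilator U' := by
  refine le_antisymm (le_inf (dualAnnihilator_anti le_sup_left) (dualAnnihilator_anti le_sup_right))
    ?_
  rintro φ ⟨h1, h2⟩ x hx
  obtain ⟨y, hy, z, hz, rfl⟩ := Submodule.mem_sup.1 hx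
  rw [map_add, h1 y hy, h2 z hz, add_zero]

theorem dualAnnihilator_inf (U U' : Submodule R V) :
    dualAnnihilator (U ⊓ U') = dualAnnihilator U ⊔ dualAnnihilator U' := by
  refine ((isRank_finrank Rᵐᵒᵖ (Dual R V)).eq_of_le
    (sup_le (dualAnnihilator_anti inf_le_left) (dualAnnihilator_anti inf_le_right)) ?_).symm
  have h1 := finrank_dualAnnihilator (U ⊓ U')
  have h2 := finrank_dualAnnihilator (U ⊔ U')
  have h3 := finrank_dualAnnihilator U
  have h4 := finrank_dualAnnihilator U'
  have h5 := Submodule.finrank_sup_add_finrank_inf_eq U U'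
  have h6 := Submodule.finrank_sup_add_finrank_inf_eq (dualAnnihilator U) (dualAnnihilator U')
  rw [← dualAnnihilator_sup] at h6
  omega

theorem IsFrame.dualAnnihilator {h : Finset (Fin n) → Submodule R V} (hn : finrank R V = n)
    (hh : IsFrame (fun P : Submodule R V => finrank R P) h) :
    IsFrame (fun P : Submodule Rᵐᵒᵖ (Dual R V) => finrank Rᵐᵒᵖ P)
      (fun I => dualAnnihilator (h Iᶜ)) where
  sup I J := by
    rw [Finset.compl_union, hh.inf (isRank_finrank R V), dualAnnihilator_inf]
  rank I := by
    have h1 := finrank_dualAnnihilator (h Iᶜ)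
    have h2 := hh.rank Iᶜ
    have h3 := Finset.card_compl_add_card I
    rw [Fintype.card_fin] at h3
    omega

/-- The codimension of the annihilator of a subspace of the dual space is at most the dimension of
this subspace. -/
theorem le_finrank_annihilator_add_finrank (T : Submodule Rᵐᵒᵖ (Dual R V)) :
    finrank R V ≤ finrank R (annihilator T) + finrank Rᵐᵒᵖ T := by
  obtain ⟨w, I, hw, rfl⟩ := exists_eq_spanOn (finrank_dual R V) T
  let φ : V →ₗ[R] (I → R) := LinearMap.pi fun i => w i
  have h1 : LinearMap.ker φ ≤ annihilator (spanOn Rᵐᵒᵖ w I) := by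
    intro x hx ψ hψ
    have h2 : spanOn Rᵐᵒᵖ w I ≤ dualAnnihilator (Submodule.span R {x}) :=
      spanOn_le fun i hi y hy => by
        obtain ⟨a, rfl⟩ := Submodule.mem_span_singleton.1 hy
        have h3 : w i x = 0 := congrFun (LinearMap.mem_ker.1 hx) ⟨i, hi⟩
        rw [map_smul, h3, smul_zero]
    exact h2 hψ x (Submodule.mem_span_singleton_self x)
  have h2 := LinearMap.finrank_range_add_finrank_ker φ
  have h3 := (isRank_finrank R V).mono h1
  have h4 := Submodule.finrank_le (LinearMap.range φ)
  rw [finrank_fintype_fun_eq_card, Fintype.card_coe] at h4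
  rw [finrank_spanOn hw]
  omega

/-- The remaining inequality holds because `T` annihilates its own annihilator, whose full space of
annihilating functionals has complementary dimension. -/
theorem finrank_annihilator (T : Submodule Rᵐᵒᵖ (Dual R V)) :
    finrank R (annihilator T) + finrank Rᵐᵒᵖ T = finrank R V := by
  refine le_antisymm ?_ (le_finrank_annihilator_add_finrank T)
  have h1 : T ≤ dualAnnihilator (annihilator T) := fun φ hφ x hx => hx φ hφ
  have h2 := (isRank_finrank Rᵐᵒᵖ (Dual R V)).mono h1
  have h3 := finrank_dualAnnihilator (annihilator T)
  omega

end DualSpace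
-- Assembling the theorem
section Main

variable {R V : Type*} [DivisionRing R] [AddCommGroup V] [Module R V] [FiniteDimensional R V]
  {R' V' : Type*} [DivisionRing R'] [AddCommGroup V'] [Module R' V'] [FiniteDimensional R' V']
  {n k : ℕ}

/-- The annihilator turns a frame into the dual frame on complementary indices and so exchanges the
two types. For `n = 2 * k` dimension `k` is kept. -/
theorem SendsApartmentsToApartments.dualAnnihilator (hn' : finrank R' V' = n) (hnk : n = 2 * k)
    {F : Submodule R V → Submodule R' V'}
    (hF : SendsApartmentsToApartments (fun P : Submodule R' V' => finrank R' P) n k F) :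
    SendsApartmentsToApartments
      (fun P : Submodule R'ᵐᵒᵖ (Dual R' V') => finrank R'ᵐᵒᵖ P) n k
      (fun P => GrassmannGraph.dualAnnihilator (F P)) := by
  intro v hv
  rcases hF v hv with ⟨h, hh, e⟩ | ⟨-, h, hh, e⟩
  · exact Or.inr ⟨hnk, _, hh.dualAnnihilator hn', fun I hI => by
      simp only [e I hI, compl_compl]⟩
  · exact Or.inl ⟨_, hh.dualAnnihilator hn', fun I hI => by simp only [e I hI]⟩

theorem mem_apartment_iff {b : Basis (Fin n) R V} {P : Gr R V k} :
    P ∈ apartment b k ↔ ∃ I : Finset (Fin n), I.card = k ∧ P.1 = spanOn R b I := by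
  constructor
  · rintro ⟨I, hI⟩
    have h1 : P.1 = spanOn R b I.toFinite.toFinset := by
      rw [hI, spanOn, Set.Finite.coe_toFinset]
    refine ⟨_, ?_, h1⟩
    rw [← finrank_spanOn b.linearIndependent, ← h1, P.2]
  · rintro ⟨I, -, hI⟩
    exact ⟨I, hI⟩

open Classical in
/-- The extension of a mapping of Grassmannians to all subspaces. -/
noncomputable def extendGr (f : Gr R V k → Gr R' V' k) (P : Submodule R V) : Submodule R' V' :=
  if h : finrank R P = k then (f ⟨P, h⟩).1 else ⊥

theorem extendGr_coe (f : Gr R V k → Gr R' V' k) (P : Gr R V k) : extendGr f P.1 = (f P).1 :=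
  dif_pos P.2

theorem image_spanOn_eq (f : Gr R V k → Gr R' V' k) (b : Basis (Fin n) R V) :
    (fun I => extendGr f (spanOn R b I)) '' {I | I.card = k} =
      Subtype.val '' (f '' apartment b k) := by
  ext Q
  constructor
  · rintro ⟨I, hI, rfl⟩
    have hP : finrank R (spanOn R b I) = k := (finrank_spanOn b.linearIndependent I).trans hI
    exact ⟨f ⟨_, hP⟩, ⟨_, mem_apartment_iff.2 ⟨I, hI, rfl⟩, rfl⟩, (extendGr_coe f ⟨_, hP⟩).symm⟩
  · rintro ⟨_, ⟨P, hP, rfl⟩, rfl⟩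
    obtain ⟨I, hI, e⟩ := mem_apartment_iff.1 hP
    refine ⟨I, hI, ?_⟩
    rw [← extendGr_coe f P, e]

theorem IsJMapping.sendsApartmentsToJohnsonFamilies {f : Gr R V k → Gr R' V' k}
    (hf : IsJMapping f) :
    SendsApartmentsToJohnsonFamilies (fun P : Submodule R' V' => finrank R' P) (finrank R V) k
      (extendGr f) := by
  classical
  intro v hv
  let b : Basis (Fin (finrank R V)) R V :=
    Basis.mk hv (hv.span_eq_top_of_card_eq_finrank' (by simp)).ge
  have hb : ⇑b = v := Basis.coe_mk _ _
  obtain ⟨g, hg, hrange⟩ := hf (apartment b k) ⟨b, rfl⟩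
  let g' : Finset (Fin (finrank R V)) → Submodule R' V' := fun I =>
    if h : I.card = k then (g ⟨I, h⟩).1 else ⊥
  have hg' : ∀ (I : Finset (Fin (finrank R V))) (h : I.card = k), g' I = (g ⟨I, h⟩).1 :=
    fun I h => dif_pos h
  refine ⟨g', fun I J hI hJ => ?_, ?_⟩
  · rw [hg' I hI, hg' J hJ]
    exact hg.finrank_inf ⟨I, hI⟩ ⟨J, hJ⟩
  · rw [← hb, image_spanOn_eq, ← hrange]
    ext Q
    constructor
    · rintro ⟨_, ⟨I, rfl⟩, rfl⟩
      exact ⟨I.1, I.2, hg' I.1 I.2⟩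
    · rintro ⟨I, hI, rfl⟩
      exact ⟨_, ⟨⟨I, hI⟩, rfl⟩, (hg' I hI).symm⟩

/-- An apartment in a parabolic subspace is part of an apartment of the whole Grassmannian. Since
`f` is injective on the source apartment and the dimensions agree, both have the same number of
members, so the part is everything. -/
theorem IsStrongJMapping.exists_mapsApartment (hn' : finrank R' V' = finrank R V)
    {f : Gr R V k → Gr R' V' k} (hf : IsStrongJMapping f) :
    ∃ v : Fin (finrank R V) → V, LinearIndependent R v ∧
      ∃ h, IsFrame (fun P : Submodule R' V' => finrank R' P) h ∧
        MapsApartment k (extendGr f) v h := by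
  obtain ⟨hJ, A, ⟨b, rfl⟩, S, U, -, b₀, -, -, hA⟩ := hf
  have hF := hJ.sendsApartmentsToJohnsonFamilies
  let b' : Basis (Fin (finrank R V)) R' V' := b₀.reindex (finCongr hn')
  have hr : IsRank (fun P : Submodule R' V' => finrank R' P) (finrank R V) :=
    hn' ▸ isRank_finrank R' V'
  have hframe := isFrame_spanOn b'.linearIndependent
  refine ⟨b, b.linearIndependent, spanOn R' b', hframe, ?_⟩
  refine Set.eq_of_subset_of_ncard_le ?_ ?_ (Set.toFinite _)
  · rw [image_spanOn_eq, hA]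
    rintro _ ⟨P, ⟨⟨I, hI⟩, -⟩, rfl⟩
    have hP : P ∈ apartment b' k := by
      refine ⟨finCongr hn' '' I, ?_⟩
      rw [hI, Basis.coe_reindex, Set.image_comp]
      congr 2
      ext x
      simp
    obtain ⟨I, hI, e⟩ := mem_apartment_iff.1 hP
    exact ⟨I, hI, e.symm⟩
  · have hinj : Set.InjOn (fun I => extendGr f (spanOn R b I)) {I | I.card = k} :=
      fun I hI J hJ e => hF.eq_of_eq b.linearIndependent hI hJ e
    rw [hinj.ncard_image, Set.InjOn.ncard_image (hframe.injective hr).injOn]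

/-- An embedding sends a base of `P` to independent functionals, so the span of `s(P)` has dimension
`k` and its annihilator has dimension `n - k`, which must be `k`. -/
theorem IsInducedByDualEmbedding.eq_two_mul (hn' : finrank R' V' = finrank R V)
    (hk : k ≤ finrank R V) {f : Gr R V k → Gr R' V' k} (hf : IsInducedByDualEmbedding f) :
    finrank R V = 2 * k := by
  obtain ⟨σ, s, hs, hfs⟩ := hf
  obtain ⟨P, hP⟩ := exists_finrank_eq (R := R) (V := V) hk
  obtain ⟨w, I, hw, rfl⟩ := exists_eq_spanOn (R := R) rfl P
  have hu := hs.2 w hw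
  have hT : Submodule.span R'ᵐᵒᵖ (s '' (spanOn R w I : Set V)) =
      spanOn R'ᵐᵒᵖ (fun i => s (w i)) I := by
    refine le_antisymm ?_ (spanOn_le fun i hi => Submodule.subset_span ⟨_, mem_spanOn hi, rfl⟩)
    rw [Submodule.span_le]
    rintro _ ⟨x, hx, rfl⟩
    have h1 : spanOn R w I ≤ (spanOn R'ᵐᵒᵖ (fun i => s (w i)) I).comap s := spanOn_le fun i hi =>
      mem_spanOn (v := fun i => s (w i)) hi
    exact h1 hx
  have h1 := finrank_annihilator (R := R') (V := V')
    (Submodule.span R'ᵐᵒᵖ (s '' (spanOn R w I : Set V)))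
  rw [← hfs ⟨_, hP⟩, (f _).2, hT, finrank_spanOn hu, hn', ← finrank_spanOn hw, hP] at h1
  omega

end Main
end GrassmannGraph

open GrassmannGraph in
theorem corollary1 {R R' V V' : Type*}
    [DivisionRing R] [AddCommGroup V] [Module R V] [FiniteDimensional R V]
    [DivisionRing R'] [AddCommGroup V'] [Module R' V'] [FiniteDimensional R' V']
    (n k : ℕ) (hn : Module.finrank R V = n) (hn' : Module.finrank R' V' = n)
    (hk : 1 < k) (hkn : k < n - 1)
    (f : Gr R V k → Gr R' V' k) (hf : IsStrongJMapping f) :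
    (IsInducedByEmbedding f ∨ IsInducedByDualEmbedding f) ∧
      (IsInducedByDualEmbedding f → n = 2 * k) := by
  subst hn
  refine ⟨?_, fun h => h.eq_two_mul hn' (by omega)⟩
  have hr : IsRank (fun P : Submodule R' V' => finrank R' P) (finrank R V) :=
    hn' ▸ isRank_finrank R' V'
  have hkn' : k + 1 < finrank R V := by omega
  obtain ⟨v, hv, h, hh, hm⟩ := hf.exists_mapsApartment hn'
  have hF := hf.1.sendsApartmentsToJohnsonFamilies.sendsApartmentsToApartments hr rfl hk hkn' hv hh
    hm
  -- The type on this single apartment decides between (1) and (2); natural type spreads to all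
  -- others, in the second case after dualizing.
  rcases hF v hv with ⟨h₁, hm₁⟩ | ⟨hnk, h₁, hh₁, e₁⟩
  · left
    obtain ⟨σ, l, hl, hlP⟩ := hF.exists_semilinearEmbedding rfl hn' hk hkn' hv hm₁
    exact ⟨σ, l, hl, fun P => by rw [← extendGr_coe f P, hlP P.1 P.2]⟩
  · right
    obtain ⟨σ, s, hs, hsP⟩ := (hF.dualAnnihilator hn' hnk).exists_semilinearEmbedding rfl
      ((finrank_dual R' V').trans hn') hk hkn' hv
      ⟨hh₁.dualAnnihilator hn', fun I hI => by rw [e₁ I hI]⟩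
    refine ⟨σ, s, hs, fun P => ?_⟩
    rw [← hsP P.1 P.2, annihilator_dualAnnihilator, extendGr_coe]
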